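/- **Setting.** A *network* $Q$ is a finite connected multigraph (loops and parallel arcs allowed) with at least one arc, in which every arc $a$ has a length $\lambda(a)>0$ and is identified with an open interval of that length. Node degrees count arc ends, so a loop counts twice; nodes of degree two do not occur (except that the circle, a single loop at one marked point, is allowed), and the line segment (one arc joining two distinct nodes) is excluded. $d(x,y)$ is the minimum length of a path from $x$ to $y$, $\lambda$ is the length (Lebesgue) measure on $Q$, and $\mu=\lambda(Q)$. A *leaf node* is a node of degree $1$, and its adjacent arc is a *leaf arc*. A *circuit* is a closed path consisting of distinct adjacent arcs. The *generalized girth* $g^*$ is the minimum of all circuit lengths and of twice the lengths of all leaf arcs. **Game.** Fix $\alpha>0$. The Patroller chooses a patrol $S:[0,\infty)\to Q$ with $d(S(t),S(t'))\le|t-t'|$ for all $t,t'$. The Attacker chooses a point $x\in Q$ and a starting time $\tau\ge 0$. The attack is intercepted (payoff $1$ to the Patroller) if $x\in S([\tau,\tau+\alpha])$; otherwise the payoff is $0$. Mixed strategies are probability measures on the pure strategies, chosen independently by the two players, and the payoff is then the interception probability. The game has value $V$ if its max-min and its min-max over mixed strategies both equal $V$. A strategy of the Patroller is optimal if it attains the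 max-min, and one of the Attacker if it attains the min-max. **Strategies.** Let $S_2$ denote a closed tour that traverses every arc exactly twice and in which (cyclically) no arc is traversed consecutively in opposite directions, except for leaf arcs. Let $S_2^\alpha:[0,L]\to Q$ be the closed path that follows $S_2$ at unit speed but stops for time $\alpha$ whenever it reaches a leaf node, $L$ being its total duration. Used as a Patroller strategy, $S_2^\alpha$ means its randomized periodic extension: the random patrol $t\mapsto S_2^\alpha((t+\Delta)\bmod L)$ with $\Delta$ uniform on $[0,L]$. A set $I\subseteq Q$ is *independent* if any two distinct points of it are at distance at least $\alpha$. For a finite independent set $I$ with $l$ elements, let $W$ be the set of points at distance at most $\alpha/2$ from $I$, and let $p=l\alpha/(\lambda(W^c)+l\alpha)$. The *independent attack strategy* on $I$ is as follows: with probability $p$, attack at an equiprobably chosen point of $I$ at an independent starting time uniform on $[0,\alpha]$; with probability $1-p$, attack at a point chosen uniformly (with respect to $\lambda$) in $W^c$ at starting time $\alpha/2$. **Theorem.** Let $Q$ be a network with $l$ leaf nodes and generalized girth $g^*$, and let $0<\alpha\le g^*$. Then: 1. The game has the value $$V=\frac{\alpha}{\mu+l\alpha/2}.$$ 2. A tour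 $S_2$ exists, and for every such tour the strategy $S_2^\alpha$ is optimal for the Patroller. 3. The set of leaf nodes is independent, and the independent attack strategy on this set is optimal for the Attacker. -/

import Mathlib

open MeasureTheory Set
open scoped ENNReal NNReal

noncomputable section

/-- The number of passages (arc ends) at the node `v`, for arcs with the given end maps;
a loop contributes two passages. -/
def passageCount {N A : Type*} (src tgt : A → N) (v : N) : ℕ :=
  Nat.card {d : A × Bool // (if d.2 then src d.1 else tgt d.1) = v}

/-- A finite connected network with nodes `N` and arcs `A`; loops and parallel arcs are allowed.
There is at least one arc, no node has degree two, and the line segment is excluded.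
(The only exception to the degree rule: the circle is allowed, presented as a single loop at an
arbitrarily marked point.) -/
structure Network (N A : Type*) where
  src : A → N
  tgt : A → N
  len : A → ℝ
  len_pos : ∀ e, 0 < len e
  arc_nonempty : Nonempty A
  connected : ∀ v w : N, Relation.ReflTransGen
    (fun a b => ∃ e, (src e = a ∧ tgt e = b) ∨ (src e = b ∧ tgt e = a)) v w
  degree_ne_two : ∀ v, passageCount src tgt v = 2 → ∀ w, w = v
  not_segment : ¬ ∃ e, src e ≠ tgt e ∧ ∀ e', e' = e

namespace Network

universe u v

variable {N : Type u} {A : Type v} (Q : Network N A)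

/-! ### Combinatorics -/

/-- The degree of a node. -/
def degree (x : N) : ℕ := passageCount Q.src Q.tgt x

/-- A leaf node is a node of degree one. -/
def IsLeaf (x : N) : Prop := Q.degree x = 1

/-- A leaf arc is an arc adjacent to a leaf node. -/
def IsLeafArc (e : A) : Prop := Q.IsLeaf (Q.src e) ∨ Q.IsLeaf (Q.tgt e)

/-- Starting node of the directed arc `d`; `(e, true)` is `e` traversed from `src e` to `tgt e`,
and `(e, false)` is `e` traversed backwards. -/
def dsrc (d : A × Bool) : N := if d.2 then Q.src d.1 else Q.tgt d.1

/-- Final node of the directed arc `d`. -/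
def dtgt (d : A × Bool) : N := if d.2 then Q.tgt d.1 else Q.src d.1

/-- A circuit: a closed path consisting of distinct adjacent arcs. -/
structure Circuit where
  darts : List (A × Bool)
  ne_nil : darts ≠ []
  closed : Cycle.Chain (fun d d' => Q.dtgt d = Q.dsrc d') (darts : Cycle (A × Bool))
  distinct : (darts.map Prod.fst).Nodup

/-- The length of a circuit. -/
def Circuit.length {Q : Network N A} (C : Q.Circuit) : ℝ :=
  (C.darts.map (fun d => Q.len d.1)).sum

/-- The girth, `∞` if there are no circuits. -/
def girth : ℝ≥0∞ := ⨅ C : Q.Circuit, ENNReal.ofReal C.length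

/-- The generalized girth: the minimum of the circuit lengths and of twice the leaf arc lengths. -/
def genGirth : ℝ≥0∞ :=
  min Q.girth (⨅ (e : A) (_ : Q.IsLeafArc e), ENNReal.ofReal (2 * Q.len e))

open Classical in
/-- A closed tour traversing every arc exactly twice, in which no arc is traversed (cyclically)
consecutively in opposite directions, except for leaf arcs. -/
structure DoubleTour where
  darts : List (A × Bool)
  closed : Cycle.Chain (fun d d' => Q.dtgt d = Q.dsrc d') (darts : Cycle (A × Bool))
  twice : ∀ e, (darts.map Prod.fst).count e = 2
  no_reversal : Cycle.Chain (fun d d' => d' = (d.1, !d.2) → Q.IsLeafArc d.1)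
    (darts : Cycle (A × Bool))

/-! ### The network as a metric measure space -/

/-- The points of the network: its nodes, and the regular points, which are the interior points of
the arcs (an arc `e` is identified with an open interval of length `len e`). -/
inductive Point : Type (max u v)
  | node (x : N) : Point
  | interior (e : A) (s : ℝ) (h0 : 0 < s) (h1 : s < Q.len e) : Point

/-- The point at distance `t` from `src e` along the arc `e`, for `0 ≤ t ≤ len e`; constant outside
of this range. -/
def onArc (e : A) (t : ℝ) : Q.Point :=
  if h : 0 < t ∧ t < Q.len e then .interior e t h.1 h.2
  else if t ≤ 0 then .node (Q.src e) else .node (Q.tgt e)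

/-- `Q.PathLen x y c`: there is a path of length `c` from `x` to `y` that is a concatenation of
finitely many segments, each running monotonically along a closed arc. -/
inductive PathLen : Q.Point → Q.Point → ℝ → Prop
  | const (x : Q.Point) : PathLen x x 0
  | segment (e : A) (s t : ℝ) (hs : s ∈ Icc 0 (Q.len e)) (ht : t ∈ Icc 0 (Q.len e)) :
      PathLen (Q.onArc e s) (Q.onArc e t) |s - t|
  | trans {x y z : Q.Point} {a b : ℝ} :
      PathLen x y a → PathLen y z b → PathLen x z (a + b)

/-- The distance between two points: the minimum length of a path between them. -/
instance : Dist Q.Point := ⟨fun x y => sInf {c | Q.PathLen x y c}⟩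

theorem dist_def (x y : Q.Point) : dist x y = sInf {c | Q.PathLen x y c} := rfl

variable {Q}

theorem PathLen.symm {x y : Q.Point} {c : ℝ} (h : Q.PathLen x y c) : Q.PathLen y x c := by
  induction h with
  | const x => exact .const x
  | segment e s t hs ht => rw [abs_sub_comm]; exact .segment e t s ht hs
  | trans _ _ h1 h2 => rw [add_comm]; exact .trans h2 h1

/-- A function that is 1-Lipschitz along every arc varies at most by the length of a path. -/
theorem PathLen.le {f : Q.Point → ℝ}
    (hf : ∀ e, ∀ s ∈ Icc 0 (Q.len e), ∀ t ∈ Icc 0 (Q.len e),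
      |f (Q.onArc e s) - f (Q.onArc e t)| ≤ |s - t|)
    {x y : Q.Point} {c : ℝ} (h : Q.PathLen x y c) : |f x - f y| ≤ c := by
  induction h with
  | const x => simp
  | segment e s t hs ht => exact hf e s hs t ht
  | trans _ _ h1 h2 => exact (abs_sub_le _ _ _).trans (add_le_add h1 h2)

theorem PathLen.nonneg {x y : Q.Point} {c : ℝ} (h : Q.PathLen x y c) : 0 ≤ c := by
  have := h.le (f := fun _ => 0) (by simp)
  simpa using this

variable (Q)

theorem onArc_of_nonpos (e : A) {t : ℝ} (h : t ≤ 0) : Q.onArc e t = .node (Q.src e) := by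
  unfold onArc
  rw [dif_neg (by intro h'; linarith [h'.1]), if_pos h]

theorem onArc_of_ge (e : A) {t : ℝ} (h : Q.len e ≤ t) : Q.onArc e t = .node (Q.tgt e) := by
  unfold onArc
  rw [dif_neg (by intro h'; linarith [h'.2]), if_neg (by linarith [Q.len_pos e])]

theorem onArc_of_mem (e : A) {t : ℝ} (h0 : 0 < t) (h1 : t < Q.len e) :
    Q.onArc e t = .interior e t h0 h1 := by
  unfold onArc
  rw [dif_pos ⟨h0, h1⟩]

theorem exists_pathLen (x y : Q.Point) : ∃ c, Q.PathLen x y c := by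
  have key : ∀ v w : N, ∃ c, Q.PathLen (.node v) (.node w) c := by
    intro v w
    induction Q.connected v w with
    | refl => exact ⟨0, .const _⟩
    | tail _ hstep ih =>
      obtain ⟨c, hc⟩ := ih
      obtain ⟨e, he⟩ := hstep
      have hp := (Q.len_pos e).le
      have h : Q.PathLen (.node (Q.src e)) (.node (Q.tgt e)) |0 - Q.len e| := by
        have := PathLen.segment (Q := Q) e 0 (Q.len e) ⟨le_rfl, hp⟩ ⟨hp, le_rfl⟩
        rwa [Q.onArc_of_nonpos e le_rfl, Q.onArc_of_ge e le_rfl] at this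
      rcases he with ⟨h1, h2⟩ | ⟨h1, h2⟩
      · rw [h1, h2] at h; exact ⟨_, hc.trans h⟩
      · rw [h1, h2] at h; exact ⟨_, hc.trans h.symm⟩
  have key2 : ∀ z : Q.Point, ∃ v c, Q.PathLen z (.node v) c := by
    intro z
    cases z with
    | node v => exact ⟨v, 0, .const _⟩
    | interior e s h0 h1 =>
      refine ⟨Q.src e, |s - 0|, ?_⟩
      have := PathLen.segment (Q := Q) e s 0 ⟨h0.le, h1.le⟩ ⟨le_rfl, (Q.len_pos e).le⟩
      rwa [Q.onArc_of_mem e h0 h1, Q.onArc_of_nonpos e le_rfl] at this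
  obtain ⟨v, a, ha⟩ := key2 x
  obtain ⟨w, b, hb⟩ := key2 y
  obtain ⟨c, hc⟩ := key v w
  exact ⟨_, (ha.trans hc).trans hb.symm⟩

variable {Q}

theorem PathLen.dist_le {x y : Q.Point} {c : ℝ} (h : Q.PathLen x y c) : dist x y ≤ c :=
  csInf_le ⟨0, fun _ h => PathLen.nonneg h⟩ h

theorem le_dist {f : Q.Point → ℝ}
    (hf : ∀ e, ∀ s ∈ Icc 0 (Q.len e), ∀ t ∈ Icc 0 (Q.len e),
      |f (Q.onArc e s) - f (Q.onArc e t)| ≤ |s - t|)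
    (x y : Q.Point) : |f x - f y| ≤ dist x y :=
  le_csInf (Q.exists_pathLen x y) fun _ h => PathLen.le hf h

theorem eq_of_dist_eq_zero_aux [Finite A] {x y : Q.Point} (h : dist x y = 0) : x = y := by
  classical
  cases x with
  | interior e s h0 h1 =>
    set r := min s (Q.len e - s) with hr
    have hrpos : 0 < r := lt_min h0 (by linarith)
    let f : Q.Point → ℝ := fun z => match z with
      | .node _ => r
      | .interior e' t _ _ => if e' = e then min r |s - t| else r
    have h1' : ∀ t ∈ Icc 0 (Q.len e), f (Q.onArc e t) = min r |s - t| := by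
      intro t ht
      rcases ht.1.eq_or_lt with h | h
      · rw [← h, Q.onArc_of_nonpos e le_rfl]
        have : r ≤ |s - 0| := by rw [sub_zero, abs_of_pos h0]; exact min_le_left _ _
        simp only [f]; rw [min_eq_left this]
      rcases ht.2.eq_or_lt with h' | h'
      · rw [h', Q.onArc_of_ge e le_rfl]
        have : r ≤ |s - Q.len e| := by
          rw [abs_sub_comm, abs_of_pos (by linarith)]; exact min_le_right _ _
        simp only [f]; rw [min_eq_left this]
      · rw [Q.onArc_of_mem e h h']; simp [f]
    have h2' : ∀ e' ≠ e, ∀ t, f (Q.onArc e' t) = r := by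
      intro e' he' t
      unfold onArc
      split_ifs <;> simp [f, he']
    have hle := le_dist (f := f) (by
      intro e' a ha b hb
      by_cases he : e' = e
      · subst he
        rw [h1' a ha, h1' b hb]
        refine (abs_min_sub_min_le_max _ _ _ _).trans (max_le (by simp) ?_)
        refine (abs_abs_sub_abs_le_abs_sub _ _).trans ?_
        rw [sub_sub_sub_cancel_left, abs_sub_comm]
      · rw [h2' e' he, h2' e' he]; simp) (.interior e s h0 h1) y
    rw [h] at hle
    have hx : f (.interior e s h0 h1) = 0 := by simp [f, hrpos.le]
    rw [hx, zero_sub, abs_neg] at hle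
    have hy : f y = 0 := abs_eq_zero.1 (le_antisymm hle (abs_nonneg _))
    cases y with
    | node w => simp only [f] at hy; linarith
    | interior e' t _ _ =>
      simp only [f] at hy
      split_ifs at hy with he
      · subst he
        have : |s - t| = 0 := by
          rcases min_choice r |s - t| with hc | hc
          · linarith
          · linarith
        have : s = t := by linarith [abs_eq_zero.1 this]
        subst this; rfl
      · linarith
  | node v =>
    have := Q.arc_nonempty
    obtain ⟨e₀, he₀⟩ := Finite.exists_min Q.len
    set r := Q.len e₀ with hr
    have hrpos : 0 < r := Q.len_pos _
    let g : N → ℝ := fun w => if w = v then 0 else r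
    have g0 : ∀ w, 0 ≤ g w := fun w => by simp only [g]; split_ifs <;> linarith
    have g1 : ∀ w, g w ≤ r := fun w => by simp only [g]; split_ifs <;> linarith
    let F : A → ℝ → ℝ := fun e t =>
      min r (min (g (Q.src e) + t) (g (Q.tgt e) + (Q.len e - t)))
    let f : Q.Point → ℝ := fun z => match z with
      | .node w => g w
      | .interior e t _ _ => F e t
    have h1' : ∀ e, ∀ t ∈ Icc 0 (Q.len e), f (Q.onArc e t) = F e t := by
      intro e t ht
      rcases ht.1.eq_or_lt with h | h
      · rw [← h, Q.onArc_of_nonpos e le_rfl]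
        simp only [f, F]
        rw [min_eq_left (a := g (Q.src e) + 0), add_zero, min_eq_right (g1 _)]
        linarith [g1 (Q.src e), g0 (Q.tgt e), he₀ e]
      rcases ht.2.eq_or_lt with h' | h'
      · rw [h', Q.onArc_of_ge e le_rfl]
        simp only [f, F]
        rw [sub_self, min_eq_right (b := g (Q.tgt e) + 0), add_zero, min_eq_right (g1 _)]
        linarith [g1 (Q.tgt e), g0 (Q.src e), he₀ e]
      · rw [Q.onArc_of_mem e h h']
    have hle := le_dist (f := f) (by
      intro e a ha b hb
      rw [h1' e a ha, h1' e b hb]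
      refine (abs_min_sub_min_le_max _ _ _ _).trans (max_le (by simp) ?_)
      refine (abs_min_sub_min_le_max _ _ _ _).trans (max_le ?_ ?_)
      · rw [add_sub_add_left_eq_sub]
      · rw [add_sub_add_left_eq_sub, sub_sub_sub_cancel_left, abs_sub_comm]) (.node v) y
    rw [h] at hle
    have hx : f (.node v) = 0 := by simp [f, g]
    rw [hx, zero_sub, abs_neg] at hle
    have hy : f y = 0 := abs_eq_zero.1 (le_antisymm hle (abs_nonneg _))
    cases y with
    | node w =>
      simp only [f, g] at hy
      split_ifs at hy with hw
      · rw [hw]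
      · linarith
    | interior e t h0 h1 =>
      have : 0 < F e t := lt_min hrpos (lt_min (by linarith [g0 (Q.src e)])
        (by linarith [g0 (Q.tgt e)]))
      simp only [f] at hy
      linarith

variable (Q)

instance [Finite A] : MetricSpace Q.Point where
  dist_self x := le_antisymm (PathLen.const x).dist_le
    (le_csInf (Q.exists_pathLen x x) fun _ h => PathLen.nonneg h)
  dist_comm x y := by
    rw [dist_def, dist_def]
    congr 1
    ext c
    exact ⟨PathLen.symm, PathLen.symm⟩
  dist_triangle x y z := by
    refine le_of_forall_pos_lt_add fun ε hε => ?_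
    obtain ⟨a, ha, ha'⟩ := exists_lt_of_csInf_lt (Q.exists_pathLen x y)
      (lt_add_of_pos_right (dist x y) (half_pos hε))
    obtain ⟨b, hb, hb'⟩ := exists_lt_of_csInf_lt (Q.exists_pathLen y z)
      (lt_add_of_pos_right (dist y z) (half_pos hε))
    have := (PathLen.trans ha hb).dist_le
    linarith
  eq_of_dist_eq_zero := eq_of_dist_eq_zero_aux

instance [Finite A] : MeasurableSpace Q.Point := borel _

instance [Finite A] : BorelSpace Q.Point := ⟨rfl⟩

/-- The measure `λ` (length) on the network: Lebesgue measure on every arc. -/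
def lengthMeasure [Fintype A] : Measure Q.Point :=
  ∑ e, (volume.restrict (Ioo 0 (Q.len e))).map (Q.onArc e)

/-- The total length `μ = λ(Q)`. -/
def totalLength [Fintype A] : ℝ := (Q.lengthMeasure univ).toReal

/-- The set of leaf nodes, as a set of points of the network. -/
def leafSet : Set Q.Point := Point.node '' {x | Q.IsLeaf x}

/-! ### The game -/

/-- Pure strategies of the Patroller: unit speed (1-Lipschitz) paths defined for all times `t ≥ 0`.
The set of patrols carries the σ-algebra generated by the evaluations at all times. -/
abbrev Patrol [Finite A] := {S : ℝ≥0 → Q.Point // LipschitzWith 1 S}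

/-- Pure strategies of the Attacker: the attacked point and the starting time of the attack. -/
abbrev Attack := Q.Point × ℝ≥0

/-- The patrol `S` intercepts the attack at `x` during `J = [τ, τ + α]`, that is, `x ∈ S(J)`. -/
def Intercepts [Finite A] (α : ℝ) (S : Q.Patrol) (a : Q.Attack) : Prop :=
  a.1 ∈ S.1 '' {t : ℝ≥0 | (a.2 : ℝ) ≤ t ∧ (t : ℝ) ≤ a.2 + α}

/-- The expected payoff to the Patroller (the interception probability) when the players
independently use the mixed strategies `σ` and `ν`. -/
def payoff [Finite A] (α : ℝ) (σ : Measure Q.Patrol) (ν : Measure Q.Attack) : ℝ≥0∞ :=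
  (σ.prod ν) {q | Q.Intercepts α q.1 q.2}

/-- The interception probability that the mixed strategy `σ` guarantees to the Patroller. -/
def patrolGuarantee [Finite A] (α : ℝ) (σ : Measure Q.Patrol) : ℝ≥0∞ :=
  ⨅ (ν : Measure Q.Attack) (_ : IsProbabilityMeasure ν), Q.payoff α σ ν

/-- The upper bound on the interception probability that the mixed strategy `ν` guarantees to the
Attacker. -/
def attackGuarantee [Finite A] (α : ℝ) (ν : Measure Q.Attack) : ℝ≥0∞ :=
  ⨆ (σ : Measure Q.Patrol) (_ : IsProbabilityMeasure σ), Q.payoff α σ ν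

/-- The max-min value of the game. -/
def lowerValue [Finite A] (α : ℝ) : ℝ≥0∞ :=
  ⨆ (σ : Measure Q.Patrol) (_ : IsProbabilityMeasure σ), Q.patrolGuarantee α σ

/-- The min-max value of the game. -/
def upperValue [Finite A] (α : ℝ) : ℝ≥0∞ :=
  ⨅ (ν : Measure Q.Attack) (_ : IsProbabilityMeasure ν), Q.attackGuarantee α ν

/-- `V` is the value of the game `(Q, α)`. -/
def IsValue [Finite A] (α V : ℝ) : Prop :=
  Q.lowerValue α = ENNReal.ofReal V ∧ Q.upperValue α = ENNReal.ofReal V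

/-- `σ` is an optimal mixed strategy of the Patroller. -/
def IsOptimalPatrol [Finite A] (α : ℝ) (σ : Measure Q.Patrol) : Prop :=
  IsProbabilityMeasure σ ∧ Q.patrolGuarantee α σ = Q.lowerValue α

/-- `ν` is an optimal mixed strategy of the Attacker. -/
def IsOptimalAttack [Finite A] (α : ℝ) (ν : Measure Q.Attack) : Prop :=
  IsProbabilityMeasure ν ∧ Q.attackGuarantee α ν = Q.upperValue α

/-! ### The independent attack strategy -/

/-- A set of points is independent if distinct points of it have distance at least `α`. -/
def IsIndependent [Finite A] (α : ℝ) (I : Set Q.Point) : Prop :=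
  ∀ x ∈ I, ∀ y ∈ I, x ≠ y → α ≤ dist x y

/-- The set `W(I)` of all points at distance at most `α / 2` from `I`. -/
def nearSet [Finite A] (α : ℝ) (I : Set Q.Point) : Set Q.Point :=
  {x | ∃ y ∈ I, dist x y ≤ α / 2}

/-- The probability `p = lα / (λ(Wᶜ) + lα)` of attacking on `I`. -/
def attackProb [Fintype A] (α : ℝ) (I : Set Q.Point) : ℝ≥0∞ :=
  (I.ncard * ENNReal.ofReal α) /
    (Q.lengthMeasure (Q.nearSet α I)ᶜ + I.ncard * ENNReal.ofReal α)

/-- The independent attack strategy for a finite set `I`: with probability `p`, attack at a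
uniformly chosen point of `I`, starting at an independent uniformly chosen time in `[0, α]`; with
probability `1 - p`, attack at a uniformly chosen point of `Wᶜ`, starting at time `α / 2`. -/
def independentAttack [Fintype A] (α : ℝ) (I : Set Q.Point) : Measure Q.Attack :=
  Q.attackProb α I • (ProbabilityTheory.uniformOn I).prod
      ((ProbabilityTheory.cond volume (Icc 0 α)).map Real.toNNReal) +
    (1 - Q.attackProb α I) • (ProbabilityTheory.cond Q.lengthMeasure (Q.nearSet α I)ᶜ).prod
      (Measure.dirac (Real.toNNReal (α / 2)))

/-! ### Randomized periodic extensions -/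

/-- A closed unit speed path `S : [0, L] → Q` (the values outside of `[0, L]` are irrelevant). -/
structure ClosedPath [Finite A] where
  L : ℝ
  L_pos : 0 < L
  S : ℝ → Q.Point
  unit_speed : LipschitzOnWith 1 S (Icc 0 L)
  closed : S 0 = S L

variable {Q}

/-- The periodic extension `S_Δ(t) = S((t + Δ) mod L)`, as a function. -/
def ClosedPath.shiftFun [Finite A] (P : Q.ClosedPath) (Δ : ℝ) (t : ℝ≥0) : Q.Point :=
  P.S (P.L * Int.fract ((t + Δ) / P.L))

theorem ClosedPath.lipschitz_shiftFun [Finite A] (P : Q.ClosedPath) (Δ : ℝ) :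
    LipschitzWith 1 (P.shiftFun Δ) := by
  have hL := P.L_pos
  have hS : ∀ x ∈ Icc 0 P.L, ∀ y ∈ Icc 0 P.L, dist (P.S x) (P.S y) ≤ |x - y| := by
    intro x hx y hy
    have := P.unit_speed.dist_le_mul x hx y hy
    simpa [Real.dist_eq] using this
  have hm : ∀ u : ℝ, P.L * Int.fract u ∈ Icc 0 P.L := fun u =>
    ⟨mul_nonneg hL.le (Int.fract_nonneg _), mul_le_of_le_one_right hL.le (Int.fract_lt_one _).le⟩
  have main : ∀ u w : ℝ, u ≤ w →
      dist (P.S (P.L * Int.fract u)) (P.S (P.L * Int.fract w)) ≤ P.L * (w - u) := by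
    intro u w huw
    rcases (Int.floor_mono huw).eq_or_lt with h | h
    · refine (hS _ (hm u) _ (hm w)).trans ?_
      have h' : (⌊u⌋ : ℝ) = ⌊w⌋ := by exact_mod_cast h
      rw [abs_sub_comm, ← mul_sub, abs_of_nonneg]
      · simp only [Int.fract]; rw [h']; apply le_of_eq; ring
      · refine mul_nonneg hL.le ?_
        simp only [Int.fract]; rw [h']; linarith
    · have h' : (⌊u⌋ : ℝ) + 1 ≤ ⌊w⌋ := by exact_mod_cast h
      have a1 := hS _ (hm u) P.L ⟨hL.le, le_rfl⟩
      have a2 := hS 0 ⟨le_rfl, hL.le⟩ _ (hm w)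
      rw [abs_sub_comm, abs_of_nonneg (by linarith [(hm u).2])] at a1
      rw [zero_sub, abs_neg, abs_of_nonneg (hm w).1, P.closed] at a2
      refine (dist_triangle _ (P.S P.L) _).trans ((add_le_add a1 a2).trans ?_)
      have : P.L - P.L * Int.fract u + P.L * Int.fract w
          = P.L * (1 - (u - ⌊u⌋) + (w - ⌊w⌋)) := by simp only [Int.fract]; ring
      rw [this]
      exact mul_le_mul_of_nonneg_left (by linarith) hL.le
  have main' : ∀ s t : ℝ≥0, s ≤ t → dist (P.shiftFun Δ s) (P.shiftFun Δ t) ≤ (t : ℝ) - s := by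
    intro s t hst
    have hst' : (s : ℝ) ≤ t := by exact_mod_cast hst
    refine (main _ _ (div_le_div_of_nonneg_right (by linarith) hL.le)).trans (le_of_eq ?_)
    field_simp
    ring
  refine LipschitzWith.of_dist_le_mul fun s t => ?_
  rw [NNReal.coe_one, one_mul, NNReal.dist_eq]
  rcases le_total s t with h | h
  · rw [abs_sub_comm]; exact (main' s t h).trans (le_abs_self _)
  · rw [dist_comm]; exact (main' t s h).trans (le_abs_self _)

/-- The periodic patrol `S_Δ`. -/
def ClosedPath.shift [Finite A] (P : Q.ClosedPath) (Δ : ℝ) : Q.Patrol :=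
  ⟨P.shiftFun Δ, P.lipschitz_shiftFun Δ⟩

/-- The randomized periodic extension of `S`: the random patrol `S_Δ`, with `Δ` uniform in
`[0, L]`. -/
def ClosedPath.randomizedExtension [Finite A] (P : Q.ClosedPath) : Measure Q.Patrol :=
  (ProbabilityTheory.cond volume (Icc 0 P.L)).map P.shift

/-! ### The tour with pauses at the leaf nodes -/

variable (Q)

/-- The position after time `t` when the directed arc `d` is traversed at unit speed, followed by a
stop at its final node. -/
def onDart (d : A × Bool) (t : ℝ) : Q.Point :=
  if d.2 then Q.onArc d.1 t else Q.onArc d.1 (Q.len d.1 - t)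

open Classical in
/-- The time spent on the directed arc `d`: its length, plus a pause of `α` if it ends at a leaf
node. -/
def dartTime (α : ℝ) (d : A × Bool) : ℝ :=
  Q.len d.1 + if Q.IsLeaf (Q.dtgt d) then α else 0

/-- The position at time `t` when the given directed arcs are traversed one after the other at unit
speed, starting at the node `x` and pausing for time `α` at every leaf node that is reached. -/
def pausedWalk (α : ℝ) : N → List (A × Bool) → ℝ → Q.Point
  | x, [], _ => .node x
  | _, d :: ds, t =>
    if t ≤ Q.dartTime α d then Q.onDart d t
    else pausedWalk α (Q.dtgt d) ds (t - Q.dartTime α d)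

theorem onArc_clamp (e : A) (t : ℝ) :
    Q.onArc e t = Q.onArc e (max 0 (min t (Q.len e))) := by
  have hp := Q.len_pos e
  rcases le_total t 0 with h | h
  · rw [Q.onArc_of_nonpos e h, min_eq_left (h.trans hp.le), max_eq_left h,
      Q.onArc_of_nonpos e le_rfl]
  · rcases le_total t (Q.len e) with h' | h'
    · rw [min_eq_left h', max_eq_right h]
    · rw [min_eq_right h', max_eq_right hp.le, Q.onArc_of_ge e h', Q.onArc_of_ge e le_rfl]

theorem dist_onArc_le [Finite A] (e : A) (s t : ℝ) :
    dist (Q.onArc e s) (Q.onArc e t) ≤ |s - t| := by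
  have hp := (Q.len_pos e).le
  have hm : ∀ u : ℝ, max 0 (min u (Q.len e)) ∈ Icc 0 (Q.len e) := fun u =>
    ⟨le_max_left _ _, max_le hp (min_le_right _ _)⟩
  rw [Q.onArc_clamp e s, Q.onArc_clamp e t]
  refine (PathLen.segment e _ _ (hm s) (hm t)).dist_le.trans ?_
  refine (abs_max_sub_max_le_max _ _ _ _).trans (max_le (by simp) ?_)
  exact (abs_min_sub_min_le_max _ _ _ _).trans (max_le le_rfl (by simp))

theorem dist_onDart_le [Finite A] (d : A × Bool) (s t : ℝ) :
    dist (Q.onDart d s) (Q.onDart d t) ≤ |s - t| := by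
  unfold onDart
  split_ifs
  · exact Q.dist_onArc_le _ _ _
  · refine (Q.dist_onArc_le _ _ _).trans ?_
    rw [sub_sub_sub_cancel_left, abs_sub_comm]

theorem onDart_of_nonpos (d : A × Bool) {t : ℝ} (h : t ≤ 0) :
    Q.onDart d t = .node (Q.dsrc d) := by
  unfold onDart dsrc
  split_ifs
  · exact Q.onArc_of_nonpos _ h
  · exact Q.onArc_of_ge _ (by linarith)

theorem onDart_of_ge (d : A × Bool) {t : ℝ} (h : Q.len d.1 ≤ t) :
    Q.onDart d t = .node (Q.dtgt d) := by
  unfold onDart dtgt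
  split_ifs
  · exact Q.onArc_of_ge _ h
  · exact Q.onArc_of_nonpos _ (by linarith)

theorem len_le_dartTime {α : ℝ} (hα : 0 < α) (d : A × Bool) : Q.len d.1 ≤ Q.dartTime α d := by
  unfold dartTime
  split_ifs <;> linarith

theorem dartTime_pos {α : ℝ} (hα : 0 < α) (d : A × Bool) : 0 < Q.dartTime α d :=
  (Q.len_pos d.1).trans_le (Q.len_le_dartTime hα d)

theorem pausedWalk_of_nonpos {α : ℝ} (hα : 0 < α) (x : N) (ds : List (A × Bool))
    (hx : ∀ d ∈ ds.head?, Q.dsrc d = x) {t : ℝ} (ht : t ≤ 0) :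
    Q.pausedWalk α x ds t = .node x := by
  cases ds with
  | nil => rfl
  | cons d ds =>
    rw [pausedWalk, if_pos (ht.trans (Q.dartTime_pos hα d).le), Q.onDart_of_nonpos d ht,
      hx d (by simp)]

theorem dist_pausedWalk_le [Finite A] {α : ℝ} (hα : 0 < α) (x : N) (ds : List (A × Bool))
    (hc : ds.IsChain (fun d d' => Q.dtgt d = Q.dsrc d')) (s t : ℝ) :
    dist (Q.pausedWalk α x ds s) (Q.pausedWalk α x ds t) ≤ |s - t| := by
  induction ds generalizing x s t with
  | nil => simp [pausedWalk]
  | cons d ds ih =>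
    have hc' : ds.IsChain (fun d d' => Q.dtgt d = Q.dsrc d') := hc.tail
    have hhead : ∀ d' ∈ ds.head?, Q.dsrc d' = Q.dtgt d := by
      intro d' hd'
      cases ds with
      | nil => simp at hd'
      | cons d'' ds =>
        simp only [List.head?_cons, Option.mem_def, Option.some.injEq] at hd'
        subst hd'
        exact (List.isChain_cons_cons.1 hc).1.symm
    wlog hst : s ≤ t generalizing s t
    · rw [dist_comm, abs_sub_comm]; exact this t s (le_of_not_ge hst)
    simp only [pausedWalk]
    split_ifs with h1 h2
    · exact Q.dist_onDart_le d s t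
    · have a1 := Q.dist_onDart_le d s (Q.dartTime α d)
      have a2 := ih (Q.dtgt d) hc' 0 (t - Q.dartTime α d)
      rw [Q.onDart_of_ge d (Q.len_le_dartTime hα d)] at a1
      rw [Q.pausedWalk_of_nonpos hα _ ds hhead le_rfl] at a2
      refine (dist_triangle _ _ _).trans ((add_le_add a1 a2).trans (le_of_eq ?_))
      rw [abs_of_nonpos (by linarith), abs_of_nonpos (by linarith), abs_of_nonpos (by linarith)]
      ring
    · linarith
    · refine (ih (Q.dtgt d) hc' _ _).trans (le_of_eq ?_)
      rw [sub_sub_sub_cancel_right]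

theorem pausedWalk_end {α : ℝ} (hα : 0 < α) (x : N) (ds : List (A × Bool))
    (hc : ds.IsChain (fun d d' => Q.dtgt d = Q.dsrc d')) (hne : ds ≠ []) :
    Q.pausedWalk α x ds (ds.map (Q.dartTime α)).sum = .node (Q.dtgt (ds.getLast hne)) := by
  induction ds generalizing x with
  | nil => exact absurd rfl hne
  | cons d ds ih =>
    cases ds with
    | nil => simp [pausedWalk, Q.onDart_of_ge d (Q.len_le_dartTime hα d)]
    | cons d' ds =>
      have hs : ∀ l : List (A × Bool), 0 ≤ (l.map (Q.dartTime α)).sum := by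
        intro l
        apply List.sum_nonneg
        intro a ha
        obtain ⟨d, _, rfl⟩ := List.mem_map.1 ha
        exact (Q.dartTime_pos hα d).le
      have h1 := ih (Q.dtgt d) hc.tail (by simp)
      rw [List.getLast_cons (by simp), ← h1, pausedWalk, if_neg]
      · congr 1
        simp
      · rw [List.map_cons, List.sum_cons, List.map_cons, List.sum_cons]
        have := hs ds
        have := Q.dartTime_pos hα d'
        linarith

variable {Q}

theorem DoubleTour.ne_nil (T : Q.DoubleTour) : T.darts ≠ [] := by
  intro h
  obtain ⟨e⟩ := Q.arc_nonempty
  have := T.twice e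
  rw [h] at this
  simp at this

theorem DoubleTour.isChain (T : Q.DoubleTour) :
    (T.darts ++ [T.darts.head T.ne_nil]).IsChain (fun d d' => Q.dtgt d = Q.dsrc d') := by
  obtain ⟨ds, hc, ht, hr⟩ := T
  cases ds with
  | nil => obtain ⟨e⟩ := Q.arc_nonempty; exact absurd (ht e) (by simp)
  | cons d ds => simpa [Cycle.chain_coe_cons] using hc

/-- The closed path `S₂^α`: it follows the trajectory of the tour `S₂` at unit speed, but stops for
time `α` whenever it reaches a leaf node. -/
def DoubleTour.paused [Finite A] (T : Q.DoubleTour) (α : ℝ) (hα : 0 < α) : Q.ClosedPath where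
  L := (T.darts.map (Q.dartTime α)).sum
  L_pos := by
    apply List.sum_pos
    · intro a ha
      obtain ⟨d, _, rfl⟩ := List.mem_map.1 ha
      exact Q.dartTime_pos hα d
    · simp [T.ne_nil]
  S := Q.pausedWalk α (Q.dsrc (T.darts.head T.ne_nil)) T.darts
  unit_speed := by
    have hc := (List.isChain_append.1 T.isChain).1
    refine LipschitzWith.lipschitzOnWith (LipschitzWith.of_dist_le_mul fun s t => ?_)
    simpa [Real.dist_eq] using Q.dist_pausedWalk_le hα _ _ hc s t
  closed := by
    have hc := List.isChain_append.1 T.isChain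
    rw [Q.pausedWalk_end hα _ _ hc.1 T.ne_nil, Q.pausedWalk_of_nonpos hα _ _ _ le_rfl]
    · congr 1
      exact (hc.2.2 _ (List.getLast_mem_getLast? T.ne_nil) _ (by simp)).symm
    · intro d hd
      rw [List.head?_eq_some_head T.ne_nil] at hd
      simp only [Option.mem_def, Option.some.injEq] at hd
      rw [hd]

end Network

end

/-! ### Geometry of the network and the Attacker's bound. -/

namespace Network

universe u v

variable {N : Type u} {A : Type v} {Q : Network N A}

/-! ### Darts at a node -/

/-! Each player can guarantee `V = α / (μ + l * α / 2)`, and `lowerValue_le_upperValue` then forces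
both values to be `V`.

Attacker. Fix a patrol. For two distinct leaf nodes, which are at distance at least `α`, the sets of
starting times in `[0, α]` at which an attack is caught overlap in a null set. If the patrol is at a
point of `Wᶜ` at time `t` in `[α / 2, 3 * α / 2]`, then it catches no leaf attack starting at `t - α
/ 2`, because such an attack requires a leaf node within distance `α / 2`. Unit speed paths do not
increase length, so caught starting times and covered length of `Wᶜ` together amount to at most `α`
(`sum_catchTimes_add_le`). The probability `p` gives equal weight to a unit of either kind, which
yields the bound `α / (λ(Wᶜ) + l * α)`; since leaf arcs have length at least `α / 2`, `λ(W) ≤ l * α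
/ 2`, and the bound is at most `V`.

Patroller. The tour with pauses lasts `L = 2 * μ + l * α`, so `V = 2 * α / L`. If a point is visited
at two times that are cyclically at least `α` apart, the random shifts that catch an attack there
fill two disjoint intervals of length `α` modulo `L` (`le_randomizedExtension_intercepts`). Such
visits exist for every point (`exists_visits`). The reason is `le_time_sub_of_closed`: a closed
portion of the tour either reaches a leaf node, where the pause takes `α`, or contains a circuit,
because there are no reversals off leaf arcs. At a leaf node the two visits are the beginning and
the end of the pause.

Existence of the tour. At each node, a permutation of the outgoing darts, fixed point free unless
the node is a leaf, prescribes how to continue after an arrival. The resulting closed walks use each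
arc twice; walks that meet are merged, one of them being reversed if necessary, until one remains
(`exists_merge`, `nonempty_doubleTour`). -/

@[simp] theorem dsrc_reverse (d : A × Bool) : Q.dsrc (d.1, !d.2) = Q.dtgt d := by
  cases d with | mk e b => cases b <;> rfl

@[simp] theorem dtgt_reverse (d : A × Bool) : Q.dtgt (d.1, !d.2) = Q.dsrc d := by
  cases d with | mk e b => cases b <;> rfl

theorem degree_eq_card (x : N) : Q.degree x = Nat.card {d : A × Bool // Q.dsrc d = x} := rfl

theorem eq_or_eq_reverse {d d' : A × Bool} (h : d.1 = d'.1) : d' = d ∨ d' = (d.1, !d.2) := by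
  obtain ⟨e, b⟩ := d
  obtain ⟨e', b'⟩ := d'
  obtain rfl : e = e' := h
  cases b <;> cases b' <;> simp

theorem IsLeaf.existsUnique_dart {x : N} (hx : Q.IsLeaf x) : ∃! d, Q.dsrc d = x := by
  have h : Nat.card {d : A × Bool // Q.dsrc d = x} = 1 := hx
  rw [Nat.card_eq_one_iff_unique] at h
  obtain ⟨hs, ⟨d, hd⟩⟩ := h
  exact ⟨d, hd, fun d' hd' => congrArg Subtype.val
    (Subsingleton.elim (⟨d', hd'⟩ : {d : A × Bool // Q.dsrc d = x}) ⟨d, hd⟩)⟩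

theorem IsLeaf.dart_unique {d d' : A × Bool} (hx : Q.IsLeaf (Q.dsrc d))
    (h : Q.dsrc d' = Q.dsrc d) : d' = d :=
  hx.existsUnique_dart.unique h rfl

theorem IsLeaf.dtgt_ne {d : A × Bool} (hx : Q.IsLeaf (Q.dsrc d)) : Q.dtgt d ≠ Q.dsrc d := by
  intro h
  have h1 : Q.dsrc (d.1, !d.2) = Q.dsrc d := by rw [dsrc_reverse, h]
  have h2 := congrArg Prod.snd (hx.dart_unique h1)
  simp at h2

theorem isLeafArc_of_dsrc {d : A × Bool} (hx : Q.IsLeaf (Q.dsrc d)) : Q.IsLeafArc d.1 := by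
  obtain ⟨e, b⟩ := d
  cases b
  · exact Or.inr hx
  · exact Or.inl hx

theorem isLeafArc_of_dtgt {d : A × Bool} (hx : Q.IsLeaf (Q.dtgt d)) : Q.IsLeafArc d.1 := by
  rw [← dsrc_reverse] at hx
  exact isLeafArc_of_dsrc (d := (d.1, !d.2)) hx

theorem IsLeafArc.dsrc_or_dtgt {d : A × Bool} (h : Q.IsLeafArc d.1) :
    Q.IsLeaf (Q.dsrc d) ∨ Q.IsLeaf (Q.dtgt d) := by
  obtain ⟨e, b⟩ := d
  cases b
  · exact h.symm
  · exact h

/-- A set of nodes that is closed under passing to the other end of an arc and is not empty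
contains every node. -/
theorem mem_of_closed {X : Set N} (hX : ∀ d, Q.dsrc d ∈ X → Q.dtgt d ∈ X) {x : N} (hx : x ∈ X)
    (y : N) : y ∈ X := by
  induction Q.connected x y with
  | refl => exact hx
  | tail _ hstep ih =>
    obtain ⟨e, ⟨h1, h2⟩ | ⟨h1, h2⟩⟩ := hstep
    · rw [← h2]; exact hX (e, true) (by simpa [dsrc, h1] using ih)
    · rw [← h1]; exact hX (e, false) (by simpa [dsrc, h2] using ih)

theorem exists_dart (x : N) : ∃ d, Q.dsrc d = x := by
  by_contra! h
  obtain ⟨e⟩ := Q.arc_nonempty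
  -- With no dart starting at `x`, the set `{x}` is vacuously closed, so it contains the source of
  -- an arc.
  exact mem_of_closed (Q := Q) (X := {y | y ∈ ({x} : Set N)})
    (fun d hd => absurd hd (h d)) rfl (Q.src e) |> h (e, true)

theorem degree_pos [Finite A] (x : N) : 0 < Q.degree x := by
  obtain ⟨d, hd⟩ := Q.exists_dart x
  rw [degree_eq_card]
  have : Nonempty {d : A × Bool // Q.dsrc d = x} := ⟨⟨d, hd⟩⟩
  exact Nat.card_pos

theorem two_le_degree [Finite A] {x : N} (hx : ¬ Q.IsLeaf x) : 2 ≤ Q.degree x := by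
  have h1 := Q.degree_pos x
  have h2 : Q.degree x ≠ 1 := hx
  omega

/-- The two ends of an arc joining leaf nodes are closed under passing along arcs, so by
connectedness the network is the excluded line segment. -/
theorem IsLeaf.not_dtgt {d : A × Bool} (hx : Q.IsLeaf (Q.dsrc d)) : ¬ Q.IsLeaf (Q.dtgt d) := by
  intro hy
  have hall := mem_of_closed (Q := Q) (X := {z | z = Q.dsrc d ∨ z = Q.dtgt d}) (by
    rintro d' (h | h)
    · right; rw [hx.dart_unique h]
    · left
      rw [← dsrc_reverse] at hy h
      rw [hy.dart_unique h, dtgt_reverse]) (Or.inl rfl)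
  refine Q.not_segment ⟨d.1, ?_, ?_⟩
  · have h := hx.dtgt_ne
    obtain ⟨e, b⟩ := d
    cases b
    · exact h
    · exact h.symm
  · intro e'
    rcases hall (Q.dsrc (e', true)) with h | h
    · rw [← hx.dart_unique h]
    · rw [← dsrc_reverse] at hy h
      have := hy.dart_unique h
      exact congrArg Prod.fst this

theorem IsLeaf.eq_of_arc_eq {d d' : A × Bool} (hx : Q.IsLeaf (Q.dsrc d))
    (hx' : Q.IsLeaf (Q.dsrc d')) (h : d.1 = d'.1) : d' = d := by
  rcases eq_or_eq_reverse h with h | h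
  · exact h
  · rw [h, dsrc_reverse] at hx'
    exact absurd hx' hx.not_dtgt

/-! ### Functions on the network -/

/-- The function on the points of the network with the values `g` at the nodes and `φ e` along the
arc `e`. -/
def arcFun (g : N → ℝ) (φ : A → ℝ → ℝ) : Q.Point → ℝ
  | .node x => g x
  | .interior e s _ _ => φ e s

theorem arcFun_onArc {g : N → ℝ} {φ : A → ℝ → ℝ} (h0 : ∀ e, φ e 0 = g (Q.src e))
    (h1 : ∀ e, φ e (Q.len e) = g (Q.tgt e)) (e : A) {t : ℝ} (ht : t ∈ Icc 0 (Q.len e)) :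
    arcFun g φ (Q.onArc e t) = φ e t := by
  rcases ht.1.eq_or_lt with h | h
  · rw [← h, Q.onArc_of_nonpos e le_rfl, h0]; rfl
  rcases ht.2.eq_or_lt with h' | h'
  · rw [h', Q.onArc_of_ge e le_rfl, h1]; rfl
  · rw [Q.onArc_of_mem e h h']; rfl

/-- The source of the lower bounds for distances below: instead of analysing paths, one exhibits a
function that is 1-Lipschitz along arcs. -/
theorem arcFun_sub_le_dist {g : N → ℝ} {φ : A → ℝ → ℝ} (h0 : ∀ e, φ e 0 = g (Q.src e))
    (h1 : ∀ e, φ e (Q.len e) = g (Q.tgt e)) (h : ∀ e s t, |φ e s - φ e t| ≤ |s - t|)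
    (x y : Q.Point) : |arcFun g φ x - arcFun g φ y| ≤ dist x y := by
  refine le_dist (fun e s hs t ht => ?_) x y
  rw [arcFun_onArc h0 h1 e hs, arcFun_onArc h0 h1 e ht]
  exact h e s t

theorem continuous_onArc [Finite A] (e : A) : Continuous (Q.onArc e) :=
  (LipschitzWith.of_dist_le_mul (K := 1) fun s t => by
    simpa [Real.dist_eq] using Q.dist_onArc_le e s t).continuous

theorem exists_onArc (x : Q.Point) : ∃ e, ∃ t ∈ Icc 0 (Q.len e), Q.onArc e t = x := by
  cases x with
  | node x =>
    obtain ⟨⟨e, b⟩, hd⟩ := Q.exists_dart x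
    have hp := (Q.len_pos e).le
    cases b
    · refine ⟨e, Q.len e, ⟨hp, le_rfl⟩, ?_⟩
      rw [Q.onArc_of_ge e le_rfl, ← hd]; rfl
    · refine ⟨e, 0, ⟨le_rfl, hp⟩, ?_⟩
      rw [Q.onArc_of_nonpos e le_rfl, ← hd]; rfl
  | interior e s h0 h1 => exact ⟨e, s, ⟨h0.le, h1.le⟩, Q.onArc_of_mem e h0 h1⟩

/-- Compactness makes the network second countable, which supplies the measurability of the distance
of two measurable maps. -/
instance [Finite A] : CompactSpace Q.Point where
  isCompact_univ := by
    have : (univ : Set Q.Point) = ⋃ e, Q.onArc e '' Icc 0 (Q.len e) := by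
      refine (eq_univ_of_forall fun x => ?_).symm
      obtain ⟨e, t, ht, h⟩ := exists_onArc x
      exact mem_iUnion.2 ⟨e, t, ht, h⟩
    rw [this]
    exact isCompact_iUnion fun e => isCompact_Icc.image (continuous_onArc e)

/-- The depth function of a dart starting at a leaf node: the length of the dart at the leaf node,
decreasing to `0` along its arc, and `0` elsewhere. -/
theorem IsLeaf.exists_depth {d : A × Bool} (hx : Q.IsLeaf (Q.dsrc d)) :
    ∃ (g : N → ℝ) (φ : A → ℝ → ℝ), (∀ e, φ e 0 = g (Q.src e)) ∧
      (∀ e, φ e (Q.len e) = g (Q.tgt e)) ∧ (∀ e s t, |φ e s - φ e t| ≤ |s - t|) ∧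
      (∀ e ≠ d.1, φ e = 0) ∧ g (Q.dsrc d) = Q.len d.1 ∧ (∀ y ≠ Q.dsrc d, g y = 0) ∧
      (φ d.1 = fun s => if d.2 then Q.len d.1 - s else s) := by
  classical
  obtain ⟨e, b⟩ := d
  have hne := hx.dtgt_ne
  have hu : ∀ e' ≠ e, ∀ b', Q.dsrc (e', b') ≠ Q.dsrc (e, b) := fun e' he' b' h =>
    he' (congrArg Prod.fst (hx.dart_unique h))
  refine ⟨fun y => if y = Q.dsrc (e, b) then Q.len e else 0,
    fun e' s => if e' = e then (if b then Q.len e - s else s) else 0, ?_, ?_, ?_, ?_, ?_, ?_, ?_⟩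
  · intro e'
    by_cases he : e' = e
    · subst he
      cases b
      · have : Q.src e' ≠ Q.dsrc (e', false) := hne
        simp [this]
      · have : Q.src e' = Q.dsrc (e', true) := rfl
        simp [this]
    · have : Q.src e' ≠ Q.dsrc (e, b) := hu e' he true
      simp [this, he]
  · intro e'
    by_cases he : e' = e
    · subst he
      cases b
      · have : Q.tgt e' = Q.dsrc (e', false) := rfl
        simp [this]
      · have : Q.tgt e' ≠ Q.dsrc (e', true) := hne
        simp [this]
    · have : Q.tgt e' ≠ Q.dsrc (e, b) := hu e' he false
      simp [this, he]
  · intro e' s t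
    beta_reduce
    split_ifs
    · rw [sub_sub_sub_cancel_left, abs_sub_comm]
    · exact le_rfl
    · simp
  · intro e' he'
    funext s
    simp [he']
  · simp
  · intro y hy
    simp [hy]
  · funext s
    simp

/-- The difference of the two depth functions is still 1-Lipschitz, as they live on different arcs;
it equals the first arc length at one leaf node and minus the second at the other. -/
theorem IsLeaf.len_add_len_le_dist {d d' : A × Bool} (hx : Q.IsLeaf (Q.dsrc d))
    (hx' : Q.IsLeaf (Q.dsrc d')) (h : d ≠ d') :
    Q.len d.1 + Q.len d'.1 ≤ dist (Point.node (Q.dsrc d) : Q.Point) (Point.node (Q.dsrc d')) := by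
  have hne : d.1 ≠ d'.1 := fun h' => h (hx.eq_of_arc_eq hx' h').symm
  have hs : Q.dsrc d ≠ Q.dsrc d' := fun h' => h (hx'.dart_unique h')
  obtain ⟨g, φ, h0, h1, hl, hz, hg, hg', -⟩ := hx.exists_depth
  obtain ⟨g', φ', h0', h1', hl', hz', hgg, hgg', -⟩ := hx'.exists_depth
  have := arcFun_sub_le_dist (Q := Q) (g := fun y => g y - g' y) (φ := fun e s => φ e s - φ' e s)
    (fun e => by simp [h0, h0']) (fun e => by simp [h1, h1'])
    (fun e s t => by
      by_cases he : e = d.1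
      · rw [hz' e (he ▸ hne)]; simpa using hl e s t
      · rw [hz e he]
        have := hl' e s t
        rw [abs_sub_comm] at this
        simpa [neg_add_eq_sub] using this)
    (Point.node (Q.dsrc d)) (Point.node (Q.dsrc d'))
  simp only [arcFun, hg, hg' _ hs.symm, hgg, hgg' _ hs] at this
  have h2 := le_abs_self (Q.len d.1 - 0 - (0 - Q.len d'.1))
  linarith

/-- A point on an arc at distance at most `r` from a leaf node lies on the leaf arc, if `r` is at
most the length of that arc. -/
theorem IsLeaf.coord_le_of_dist_le {d : A × Bool} (hx : Q.IsLeaf (Q.dsrc d)) {r : ℝ}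
    (hr : r ≤ Q.len d.1) {e : A} {s : ℝ} (hs : s ∈ Ioo 0 (Q.len e))
    (h : dist (Q.onArc e s) (Point.node (Q.dsrc d)) ≤ r) :
    e = d.1 ∧ (if d.2 then s else Q.len d.1 - s) ≤ r := by
  classical
  obtain ⟨g, φ, h0, h1, hl, hz, hg, hg', hφ⟩ := hx.exists_depth
  -- Minus the depth on the leaf arc and a tent on every other arc. It is lowest at the leaf node,
  -- with value `-len d.1`, and positive inside the other arcs, which are therefore at distance more
  -- than `len d.1`.
  let ψ : A → ℝ → ℝ := fun e' s => if e' = d.1 then - φ e' s else min s (Q.len e' - s)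
  have hmin : ∀ a s t : ℝ, |min s (a - s) - min t (a - t)| ≤ |s - t| := fun a s t => by
    refine (abs_min_sub_min_le_max _ _ _ _).trans (max_le le_rfl ?_)
    rw [sub_sub_sub_cancel_left, abs_sub_comm]
  have h0' : ∀ e', ψ e' 0 = - g (Q.src e') := by
    intro e'
    simp only [ψ]
    split_ifs with he
    · rw [h0]
    · rw [← h0, hz e' he]
      simp [(Q.len_pos e').le]
  have h1' : ∀ e', ψ e' (Q.len e') = - g (Q.tgt e') := by
    intro e'
    simp only [ψ]
    split_ifs with he
    · rw [h1]
    · rw [← h1, hz e' he]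
      simp [(Q.len_pos e').le]
  have key := arcFun_sub_le_dist (Q := Q) (g := fun y => - g y) (φ := ψ) h0' h1' (by
    intro e' s t
    simp only [ψ]
    split_ifs
    · rw [neg_sub_neg, abs_sub_comm]; exact hl e' s t
    · exact hmin _ _ _) (Q.onArc e s) (Point.node (Q.dsrc d))
  rw [arcFun_onArc h0' h1' e ⟨hs.1.le, hs.2.le⟩] at key
  simp only [arcFun, hg, ψ] at key
  have key' := (le_abs_self _).trans (key.trans h)
  by_cases he : e = d.1
  · subst he
    refine ⟨rfl, ?_⟩
    rw [if_pos rfl, hφ] at key'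
    split_ifs at key' ⊢ <;> linarith
  · rw [if_neg he] at key'
    have : 0 < min s (Q.len e - s) := lt_min hs.1 (by linarith [hs.2])
    linarith

/-! ### The length measure -/

theorem lengthMeasure_apply [Fintype A] {B : Set Q.Point} (hB : MeasurableSet B) :
    Q.lengthMeasure B = ∑ e, volume (Q.onArc e ⁻¹' B ∩ Ioo 0 (Q.len e)) := by
  simp only [lengthMeasure, Measure.coe_finsetSum, Finset.sum_apply]
  refine Finset.sum_congr rfl fun e _ => ?_
  rw [Measure.map_apply (continuous_onArc e).measurable hB,
    Measure.restrict_apply ((continuous_onArc e).measurable hB)]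

theorem lengthMeasure_univ [Fintype A] :
    Q.lengthMeasure univ = ENNReal.ofReal (∑ e, Q.len e) := by
  rw [lengthMeasure_apply MeasurableSet.univ,
    ENNReal.ofReal_sum_of_nonneg fun e _ => (Q.len_pos e).le]
  simp

instance [Fintype A] : IsFiniteMeasure Q.lengthMeasure :=
  ⟨by rw [lengthMeasure_univ]; exact ENNReal.ofReal_lt_top⟩

theorem totalLength_eq [Fintype A] : Q.totalLength = ∑ e, Q.len e := by
  rw [totalLength, lengthMeasure_univ,
    ENNReal.toReal_ofReal (Finset.sum_nonneg fun e _ => (Q.len_pos e).le)]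

theorem totalLength_pos [Fintype A] : 0 < Q.totalLength := by
  rw [totalLength_eq]
  have := Q.arc_nonempty
  exact Finset.sum_pos (fun e _ => Q.len_pos e) Finset.univ_nonempty

theorem lengthMeasure_eq_ofReal [Fintype A] :
    Q.lengthMeasure univ = ENNReal.ofReal Q.totalLength := by
  rw [totalLength, ENNReal.ofReal_toReal (measure_ne_top _ _)]

/-- Up to nodes, such a ball is contained in a segment of length `r` of the leaf arc. -/
theorem IsLeaf.lengthMeasure_closedBall_le [Fintype A] {d : A × Bool} (hx : Q.IsLeaf (Q.dsrc d))
    {r : ℝ} (hr : r ≤ Q.len d.1) :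
    Q.lengthMeasure (Metric.closedBall (Point.node (Q.dsrc d)) r) ≤ ENNReal.ofReal r := by
  classical
  rw [lengthMeasure_apply Metric.isClosed_closedBall.measurableSet,
    Finset.sum_eq_single_of_mem d.1 (Finset.mem_univ _)]
  · refine (measure_mono (t := if d.2 then Icc 0 r else Icc (Q.len d.1 - r) (Q.len d.1))
      fun s hs => ?_).trans ?_
    · have h := (hx.coord_le_of_dist_le hr hs.2 hs.1).2
      obtain ⟨h0, h1⟩ := hs.2
      split_ifs at h ⊢
      · exact ⟨h0.le, h⟩
      · exact ⟨by linarith, h1.le⟩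
    · split_ifs <;> simp
  · intro e _ he
    have : Q.onArc e ⁻¹' Metric.closedBall (Point.node (Q.dsrc d)) r ∩ Ioo 0 (Q.len e) = ∅ := by
      refine eq_empty_of_forall_notMem fun s hs => ?_
      exact he (hx.coord_le_of_dist_le hr hs.2 hs.1).1
    rw [this, measure_empty]

/-! ### Unit speed paths do not increase length -/

theorem injOn_onArc (e : A) : InjOn (Q.onArc e) (Ioo 0 (Q.len e)) := by
  intro s hs t ht h
  rw [Q.onArc_of_mem e hs.1 hs.2, Q.onArc_of_mem e ht.1 ht.2] at h
  injection h

theorem onArc_eq_onArc_iff {e e' : A} {s t : ℝ} (hs : s ∈ Ioo 0 (Q.len e))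
    (ht : t ∈ Ioo 0 (Q.len e')) : Q.onArc e s = Q.onArc e' t ↔ e = e' ∧ s = t := by
  rw [Q.onArc_of_mem e hs.1 hs.2, Q.onArc_of_mem e' ht.1 ht.2]
  constructor
  · intro h; injection h with h1 h2; exact ⟨h1, h2⟩
  · rintro ⟨rfl, rfl⟩; rfl

theorem measurableSet_onArc_image [Finite A] {e : A} {I : Set ℝ} (hI : MeasurableSet I)
    (h : I ⊆ Ioo 0 (Q.len e)) : MeasurableSet (Q.onArc e '' I) :=
  hI.image_of_continuousOn_injOn (continuous_onArc e).continuousOn ((injOn_onArc e).mono h)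

/-- The distance from the ends of the arc `e` is a 1-Lipschitz function, vanishing off `e`. -/
theorem exists_arc_height [Finite A] (e : A) : ∃ f : Q.Point → ℝ, LipschitzWith 1 f ∧
    ∀ s ∈ Icc 0 (Q.len e), f (Q.onArc e s) = min s (Q.len e - s) := by
  classical
  let φ : A → ℝ → ℝ := fun e' s => if e' = e then min s (Q.len e' - s) else 0
  have h0 : ∀ e', φ e' 0 = (fun _ => (0 : ℝ)) (Q.src e') := fun e' => by
    simp [φ, (Q.len_pos e').le]
  have h1 : ∀ e', φ e' (Q.len e') = (fun _ => (0 : ℝ)) (Q.tgt e') := fun e' => by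
    simp [φ, (Q.len_pos e').le]
  refine ⟨arcFun (fun _ => 0) φ, LipschitzWith.of_dist_le_mul fun x y => ?_, fun s hs => ?_⟩
  · rw [NNReal.coe_one, one_mul, Real.dist_eq]
    refine arcFun_sub_le_dist h0 h1 (fun e' s t => ?_) x y
    simp only [φ]
    split_ifs
    · refine (abs_min_sub_min_le_max _ _ _ _).trans (max_le le_rfl ?_)
      rw [sub_sub_sub_cancel_left, abs_sub_comm]
    · simp
  · rw [arcFun_onArc h0 h1 e hs]
    simp [φ]

/-- Lebesgue measure on the line is one-dimensional Hausdorff measure, so `E` need not be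
measurable. -/
theorem volume_image_le_of_lipschitz {f : ℝ → ℝ} (hf : LipschitzWith 1 f) (E : Set ℝ) :
    volume (f '' E) ≤ volume E := by
  have := hf.hausdorffMeasure_image_le (d := 1) zero_le_one E
  simpa [MeasureTheory.hausdorffMeasure_real] using this

/-- The two halves of an arc. -/
def halfArc (Q : Network N A) (i : A × Bool) : Set ℝ :=
  if i.2 then Ioc 0 (Q.len i.1 / 2) else Ioo (Q.len i.1 / 2) (Q.len i.1)

theorem measurableSet_halfArc (i : A × Bool) : MeasurableSet (Q.halfArc i) := by
  unfold halfArc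
  split_ifs
  · exact measurableSet_Ioc
  · exact measurableSet_Ioo

theorem halfArc_subset (i : A × Bool) : Q.halfArc i ⊆ Ioo 0 (Q.len i.1) := by
  intro s hs
  have hp := Q.len_pos i.1
  unfold halfArc at hs
  split_ifs at hs
  · exact ⟨hs.1, by linarith [hs.2]⟩
  · exact ⟨by linarith [hs.1], hs.2⟩

theorem disjoint_halfArc_image {i j : A × Bool} (hij : i ≠ j) :
    Disjoint (Q.onArc i.1 '' Q.halfArc i) (Q.onArc j.1 '' Q.halfArc j) := by
  rw [Set.disjoint_left]
  rintro z ⟨s, hs, hst⟩ ⟨s', hs', hst'⟩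
  obtain ⟨h1, rfl⟩ := (onArc_eq_onArc_iff (halfArc_subset i hs) (halfArc_subset j hs')).1
    (hst.trans hst'.symm)
  obtain ⟨e, b⟩ := i
  obtain ⟨e', b'⟩ := j
  dsimp only at h1
  subst h1
  cases b <;> cases b' <;> simp only [halfArc, if_true, Bool.false_eq_true, if_false] at hs hs'
  · exact hij rfl
  · linarith [hs.1, hs'.2]
  · linarith [hs.2, hs'.1]
  · exact hij rfl

/-- The height function determines the position on each half of an arc. Composed with `S`, and
reflected for the second half, it is a 1-Lipschitz real function that sends the times spent on the
half arc to the coordinates visited. -/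
theorem volume_halfArc_le [Finite A] {S : ℝ → Q.Point} (hS : LipschitzWith 1 S)
    {B : Set Q.Point} {E : Set ℝ} (h : B ⊆ S '' E) (i : A × Bool) :
    volume (Q.onArc i.1 ⁻¹' B ∩ Q.halfArc i) ≤
      volume (E ∩ S ⁻¹' (Q.onArc i.1 '' Q.halfArc i)) := by
  obtain ⟨f, hf, hfe⟩ := exists_arc_height (Q := Q) i.1
  let r : ℝ → ℝ := fun u => if i.2 then u else Q.len i.1 - u
  have hr : LipschitzWith 1 r := LipschitzWith.of_dist_le_mul fun s t => by
    simp only [r, Real.dist_eq, NNReal.coe_one, one_mul]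
    split_ifs
    · exact le_rfl
    · rw [sub_sub_sub_cancel_left, abs_sub_comm]
  have hrf : LipschitzWith 1 (r ∘ f ∘ S) := by
    have := hr.comp (hf.comp hS)
    rwa [one_mul, one_mul] at this
  refine (measure_mono fun s hs => ?_).trans (volume_image_le_of_lipschitz hrf _)
  obtain ⟨t, ht, hst⟩ := h hs.1
  refine ⟨t, ⟨ht, s, hs.2, hst.symm⟩, ?_⟩
  have hs' := halfArc_subset i hs.2
  have hs2 := hs.2
  simp only [Function.comp_apply, hst, hfe s ⟨hs'.1.le, hs'.2.le⟩, r]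
  unfold halfArc at hs2
  split_ifs at hs2 ⊢
  · exact min_eq_left (by linarith [hs2.2])
  · rw [min_eq_right (by linarith [hs2.1])]; ring

/-- The half arcs are disjoint, hence so are the sets of times spent on them, and the bounds for the
halves add up. -/
theorem lengthMeasure_le_of_subset_image [Fintype A] {S : ℝ → Q.Point} (hS : LipschitzWith 1 S)
    {B : Set Q.Point} (hB : MeasurableSet B) {E : Set ℝ} (hE : MeasurableSet E)
    (h : B ⊆ S '' E) : Q.lengthMeasure B ≤ volume E := by
  rw [lengthMeasure_apply hB]
  calc ∑ e, volume (Q.onArc e ⁻¹' B ∩ Ioo 0 (Q.len e))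
      ≤ ∑ e, ∑ b, volume (Q.onArc e ⁻¹' B ∩ Q.halfArc (e, b)) := by
        refine Finset.sum_le_sum fun e _ => ?_
        rw [Fintype.sum_bool]
        refine (measure_mono fun s hs => ?_).trans (measure_union_le _ _)
        rcases le_or_gt s (Q.len e / 2) with h' | h'
        · exact Or.inl ⟨hs.1, hs.2.1, h'⟩
        · exact Or.inr ⟨hs.1, h', hs.2.2⟩
    _ = ∑ i : A × Bool, volume (Q.onArc i.1 ⁻¹' B ∩ Q.halfArc i) :=
        (Fintype.sum_prod_type
          fun i : A × Bool => volume (Q.onArc i.1 ⁻¹' B ∩ Q.halfArc i)).symm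
    _ ≤ ∑ i : A × Bool, volume (E ∩ S ⁻¹' (Q.onArc i.1 '' Q.halfArc i)) :=
        Finset.sum_le_sum fun i _ => volume_halfArc_le hS h i
    _ = volume (⋃ i ∈ (Finset.univ : Finset (A × Bool)),
          E ∩ S ⁻¹' (Q.onArc i.1 '' Q.halfArc i)) :=
        (measure_biUnion_finset (fun i _ j _ hij =>
          ((disjoint_halfArc_image hij).preimage S).mono inter_subset_right inter_subset_right)
          fun i _ => hE.inter (hS.continuous.measurable
            (measurableSet_onArc_image (measurableSet_halfArc i) (halfArc_subset i)))).symm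
    _ ≤ volume E := measure_mono (iUnion₂_subset fun i _ => inter_subset_left)

/-! ### Interception by a single patrol -/

/-- The patrol as a function on the real line, constant for negative times. -/
def Patrol.path [Finite A] (S : Q.Patrol) (t : ℝ) : Q.Point := S.1 t.toNNReal

theorem Patrol.lipschitz_path [Finite A] (S : Q.Patrol) : LipschitzWith 1 S.path := by
  have : LipschitzWith 1 Real.toNNReal := LipschitzWith.of_dist_le_mul fun s t => by
    rw [NNReal.dist_eq, NNReal.coe_one, one_mul, Real.dist_eq, Real.coe_toNNReal',
      Real.coe_toNNReal']
    exact (abs_max_sub_max_le_max _ _ _ _).trans (by simp)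
  have h := S.2.comp this
  rwa [one_mul] at h

theorem Patrol.dist_path_le [Finite A] (S : Q.Patrol) (s t : ℝ) :
    dist (S.path s) (S.path t) ≤ |s - t| := by
  simpa [Real.dist_eq] using S.lipschitz_path.dist_le_mul s t

theorem intercepts_iff [Finite A] {α : ℝ} {S : Q.Patrol} {x : Q.Point} {τ : ℝ≥0} :
    Q.Intercepts α S (x, τ) ↔ ∃ t ∈ Icc (τ : ℝ) (τ + α), S.path t = x := by
  constructor
  · rintro ⟨t, ht, rfl⟩
    exact ⟨t, ht, by simp [Patrol.path]⟩
  · rintro ⟨t, ht, rfl⟩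
    have h0 : 0 ≤ t := τ.2.trans ht.1
    exact ⟨t.toNNReal, by rw [mem_ofPred_eq, Real.coe_toNNReal t h0]; exact ht, rfl⟩

/-- Joint measurability, needed for Fubini. By continuity and compactness, interception means that
for every `k` some time of a countable dense set brings the patrol within `1 / (k + 1)` of the
attacked point. -/
theorem measurableSet_intercepts [Finite A] {α : ℝ} (hα : 0 < α) :
    MeasurableSet {q : Q.Patrol × Q.Attack | Q.Intercepts α q.1 q.2} := by
  have : Nonempty (Icc 0 α) := ⟨⟨0, le_rfl, hα.le⟩⟩
  let r : ℕ → Icc 0 α := TopologicalSpace.denseSeq (Icc 0 α)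
  have hrd : DenseRange r := TopologicalSpace.denseRange_denseSeq _
  have heq : {q : Q.Patrol × Q.Attack | Q.Intercepts α q.1 q.2} =
      ⋂ k : ℕ, ⋃ n : ℕ, {q | dist (q.1.1 (q.2.2 + (r n : ℝ).toNNReal)) q.2.1 < 1 / (k + 1)} := by
    ext ⟨S, x, τ⟩
    have hcoe : ∀ n, S.1 (τ + (r n : ℝ).toNNReal) = S.path (τ + r n) := fun n => by
      rw [Patrol.path, Real.toNNReal_add τ.coe_nonneg (r n).2.1, Real.toNNReal_coe]
    simp only [mem_ofPred_eq, intercepts_iff, mem_iInter, mem_iUnion, hcoe]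
    constructor
    · rintro ⟨t, ht, rfl⟩ k
      have hk : (0 : ℝ) < 1 / (k + 1) := Nat.one_div_pos_of_nat
      obtain ⟨n, hn⟩ := hrd.exists_dist_lt
        (⟨t - τ, by linarith [ht.1], by linarith [ht.2]⟩ : Icc 0 α) hk
      refine ⟨n, (S.dist_path_le _ _).trans_lt ?_⟩
      rw [Subtype.dist_eq, Real.dist_eq, abs_sub_comm] at hn
      rwa [show (τ + r n - t : ℝ) = r n - (t - τ) by ring]
    · intro h
      have hcont : Continuous fun c => dist (S.path (τ + c)) x :=
        (S.lipschitz_path.continuous.comp (continuous_const.add continuous_id)).dist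
          continuous_const
      obtain ⟨c, hc, hmin⟩ := isCompact_Icc.exists_isMinOn (nonempty_Icc.2 hα.le)
        hcont.continuousOn
      refine ⟨τ + c, ⟨by linarith [hc.1], by linarith [hc.2]⟩, ?_⟩
      rw [← dist_le_zero]
      refine le_of_forall_pos_lt_add fun ε hε => ?_
      obtain ⟨k, hk⟩ := exists_nat_one_div_lt hε
      obtain ⟨n, hn⟩ := h k
      have hmin' : dist (S.path (τ + c)) x ≤ dist (S.path (τ + r n)) x := hmin (r n).2
      linarith
  rw [heq]
  -- Evaluation is continuous in time and measurable in the patrol, hence jointly measurable.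
  have hev : Measurable (Function.uncurry fun (t : ℝ≥0) (S : Q.Patrol) => S.1 t) :=
    measurable_uncurry_of_continuous_of_measurable (fun S => S.2.continuous)
      fun t => (measurable_pi_apply t).comp measurable_subtype_coe
  refine MeasurableSet.iInter fun k => MeasurableSet.iUnion fun n => ?_
  have h1 : Measurable fun q : Q.Patrol × Q.Attack => q.1.1 (q.2.2 + (r n : ℝ).toNNReal) :=
    hev.comp (((measurable_snd.comp measurable_snd).add_const _).prodMk measurable_fst)
  exact measurableSet_lt (h1.dist (measurable_fst.comp measurable_snd)) measurable_const

/-- The starting times in `[0, α]` of the attacks at `x` that the patrol intercepts. -/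
def catchTimes [Finite A] (α : ℝ) (S : Q.Patrol) (x : Q.Point) : Set ℝ :=
  {τ | τ ∈ Icc 0 α ∧ ∃ t ∈ Icc τ (τ + α), S.path t = x}

theorem measurableSet_intercepts_right [Finite A] {α : ℝ} (hα : 0 < α) (S : Q.Patrol) :
    MeasurableSet {a : Q.Attack | Q.Intercepts α S a} :=
  (measurableSet_intercepts hα).preimage measurable_prodMk_left

theorem catchTimes_eq [Finite A] {α : ℝ} (S : Q.Patrol) (x : Q.Point) :
    catchTimes α S x =
      Icc 0 α ∩ (fun τ : ℝ => (x, τ.toNNReal)) ⁻¹' {a : Q.Attack | Q.Intercepts α S a} := by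
  ext τ
  simp only [catchTimes, mem_ofPred_eq, mem_inter_iff, mem_preimage, intercepts_iff]
  refine and_congr_right fun h => ?_
  rw [Real.coe_toNNReal τ h.1]

theorem measurableSet_catchTimes [Finite A] {α : ℝ} (hα : 0 < α) (S : Q.Patrol) (x : Q.Point) :
    MeasurableSet (catchTimes α S x) := by
  rw [catchTimes_eq]
  exact measurableSet_Icc.inter ((measurableSet_intercepts_right hα S).preimage
    (measurable_const.prodMk measurable_real_toNNReal))

/-- Two attacks at points at distance at least `α` are both intercepted only if the patrol starts
at one of the points and ends at the other. -/
theorem path_eq_of_mem_catchTimes [Finite A] {α : ℝ} {S : Q.Patrol} {x y : Q.Point}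
    (hxy : α ≤ dist x y) {τ : ℝ} (hx : τ ∈ catchTimes α S x) (hy : τ ∈ catchTimes α S y) :
    (S.path τ = x ∧ S.path (τ + α) = y) ∨ (S.path τ = y ∧ S.path (τ + α) = x) := by
  obtain ⟨-, t, ht, rfl⟩ := hx
  obtain ⟨-, t', ht', rfl⟩ := hy
  have h := hxy.trans (S.dist_path_le t t')
  rcases abs_cases (t - t') with ⟨h1, -⟩ | ⟨h1, -⟩
  · have h2 : t' = τ := by linarith [ht.2, ht'.1]
    have h3 : t = τ + α := by linarith [ht.2, ht'.1]
    exact Or.inr ⟨by rw [h2], by rw [h3]⟩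
  · have h2 : t = τ := by linarith [ht'.2, ht.1]
    have h3 : t' = τ + α := by linarith [ht'.2, ht.1]
    exact Or.inl ⟨by rw [h2], by rw [h3]⟩

/-- For two such times `τ < τ'` the patrol would be at `x` at time `τ'` and at `y` at time `τ + α`,
and these times are less than `α` apart. -/
theorem subsingleton_crossing_times [Finite A] {α : ℝ} (hα : 0 < α) {S : Q.Patrol}
    {x y : Q.Point} (hxy : α ≤ dist x y) :
    {τ | τ ∈ Icc 0 α ∧ S.path τ = x ∧ S.path (τ + α) = y}.Subsingleton := by
  have key : ∀ τ ∈ Icc 0 α, ∀ τ' ∈ Icc 0 α, τ < τ' → S.path (τ + α) = y → S.path τ' = x →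
      False := by
    rintro τ hτ τ' hτ' h rfl rfl
    have := hxy.trans (S.dist_path_le τ' (τ + α))
    rcases abs_cases (τ' - (τ + α)) with ⟨h1, -⟩ | ⟨h1, -⟩ <;> linarith [hτ.1, hτ'.2]
  rintro τ ⟨h1, h2, h3⟩ τ' ⟨h1', h2', h3'⟩
  rcases lt_trichotomy τ τ' with h | h | h
  · exact (key τ h1 τ' h1' h h3 h2').elim
  · exact h
  · exact (key τ' h1' τ h1 h h3' h2).elim

theorem aedisjoint_catchTimes [Finite A] {α : ℝ} (hα : 0 < α) (S : Q.Patrol) {x y : Q.Point}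
    (hxy : α ≤ dist x y) : AEDisjoint volume (catchTimes α S x) (catchTimes α S y) := by
  have hyx : α ≤ dist y x := by rwa [dist_comm]
  refine measure_mono_null (t := {τ | τ ∈ Icc 0 α ∧ S.path τ = x ∧ S.path (τ + α) = y} ∪
    {τ | τ ∈ Icc 0 α ∧ S.path τ = y ∧ S.path (τ + α) = x}) ?_
    (measure_union_null ((subsingleton_crossing_times hα hxy).measure_zero _)
      ((subsingleton_crossing_times hα hyx).measure_zero _))
  rintro τ ⟨h, h'⟩
  rcases path_eq_of_mem_catchTimes hxy h h' with h2 | h2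
  · exact Or.inl ⟨h.1, h2⟩
  · exact Or.inr ⟨h.1, h2⟩

theorem isClosed_nearSet [Finite A] {α : ℝ} {I : Set Q.Point} (hI : I.Finite) :
    IsClosed (Q.nearSet α I) := by
  have : Q.nearSet α I = ⋃ y ∈ I, Metric.closedBall y (α / 2) := by
    ext x
    simp [nearSet]
  rw [this]
  exact hI.isClosed_biUnion fun _ _ => Metric.isClosed_closedBall

/-- The times at which attacks on an independent set are caught are times that the patrol does not
spend away from the set. -/
theorem sum_catchTimes_add_le [Fintype A] {α : ℝ} (hα : 0 < α) (S : Q.Patrol)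
    (I : Finset Q.Point) (hI : Q.IsIndependent α I) :
    ∑ x ∈ I, volume (catchTimes α S x) +
      Q.lengthMeasure ((Q.nearSet α I)ᶜ ∩ S.path '' Icc (α / 2) (α / 2 + α)) ≤
        ENNReal.ofReal α := by
  set C := ⋃ x ∈ I, catchTimes α S x with hC
  have hCm : MeasurableSet C :=
    Finset.measurableSet_biUnion _ fun x _ => measurableSet_catchTimes hα S x
  have hCs : C ⊆ Icc 0 α := iUnion₂_subset fun x _ τ hτ => hτ.1
  have h1 : ∑ x ∈ I, volume (catchTimes α S x) = volume C :=
    (measure_biUnion_finset₀ (fun x hx y hy hxy => aedisjoint_catchTimes hα S (hI x hx y hy hxy))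
      fun x _ => (measurableSet_catchTimes hα S x).nullMeasurableSet).symm
  have hS' : LipschitzWith 1 fun t => S.path (t + α / 2) :=
    LipschitzWith.of_dist_le_mul fun s t => by
      rw [NNReal.coe_one, one_mul, Real.dist_eq]
      exact (S.dist_path_le _ _).trans (by rw [add_sub_add_right_eq_sub])
  have h2 : Q.lengthMeasure ((Q.nearSet α I)ᶜ ∩ S.path '' Icc (α / 2) (α / 2 + α)) ≤
      volume (Icc 0 α \ C) := by
    refine lengthMeasure_le_of_subset_image hS'
      ((isClosed_nearSet I.finite_toSet).measurableSet.compl.inter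
        (isCompact_Icc.image S.lipschitz_path.continuous).isClosed.measurableSet)
      (measurableSet_Icc.diff hCm) ?_
    rintro z ⟨hz, t, ht, rfl⟩
    -- If an attack on `x ∈ I` starting at `t - α / 2` were caught, the patrol would be at `x`
    -- within time `α / 2` of `t`, so its position at `t` would lie in `W`.
    refine ⟨t - α / 2, ⟨⟨by linarith [ht.1], by linarith [ht.2]⟩, fun hc => hz ?_⟩, by simp⟩
    obtain ⟨x, hx, -, t', ht', rfl⟩ := mem_iUnion₂.1 hc
    refine ⟨_, hx, (S.dist_path_le _ _).trans (abs_le.2 ⟨?_, ?_⟩)⟩ <;> linarith [ht'.1, ht'.2]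
  calc _ ≤ volume C + volume (Icc 0 α \ C) := by rw [h1]; gcongr
    _ = volume (Icc 0 α) := by
        rw [← measure_inter_add_sdiff (Icc 0 α) hCm, inter_eq_right.2 hCs]
    _ = ENNReal.ofReal α := by simp

/-! ### The independent attack strategy -/

theorem attackProb_coe [Fintype A] {α : ℝ} (I : Finset Q.Point) :
    Q.attackProb α I = (I.card * ENNReal.ofReal α) /
      (Q.lengthMeasure (Q.nearSet α I)ᶜ + I.card * ENNReal.ofReal α) := by
  rw [attackProb, Set.ncard_coe_finset]

theorem attackDenom_ne_zero [Fintype A] {α : ℝ} (hα : 0 < α) (I : Finset Q.Point) :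
    Q.lengthMeasure (Q.nearSet α I)ᶜ + I.card * ENNReal.ofReal α ≠ 0 := by
  intro h
  rw [add_eq_zero, mul_eq_zero] at h
  obtain ⟨h1, h2 | h2⟩ := h
  -- For empty `I` the first summand is the whole length of the network.
  · have h2 : I = ∅ := by simpa using h2
    subst h2
    have : (Q.nearSet α ((∅ : Finset Q.Point) : Set Q.Point)) = ∅ := by ext; simp [nearSet]
    rw [this, compl_empty, lengthMeasure_eq_ofReal, ENNReal.ofReal_eq_zero] at h1
    exact absurd Q.totalLength_pos (not_lt.2 h1)
  · exact absurd hα (not_lt.2 (ENNReal.ofReal_eq_zero.1 h2))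

theorem attackDenom_ne_top [Fintype A] {α : ℝ} (I : Finset Q.Point) :
    Q.lengthMeasure (Q.nearSet α I)ᶜ + I.card * ENNReal.ofReal α ≠ ⊤ :=
  ENNReal.add_ne_top.2 ⟨measure_ne_top _ _, ENNReal.mul_ne_top (by simp) ENNReal.ofReal_ne_top⟩

theorem one_sub_attackProb [Fintype A] {α : ℝ} (hα : 0 < α) (I : Finset Q.Point) :
    1 - Q.attackProb α I = Q.lengthMeasure (Q.nearSet α I)ᶜ /
      (Q.lengthMeasure (Q.nearSet α I)ᶜ + I.card * ENNReal.ofReal α) := by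
  have h0 := attackDenom_ne_zero hα I
  have ht := attackDenom_ne_top (α := α) I
  rw [attackProb_coe]
  refine ENNReal.sub_eq_of_eq_add ?_ ?_
  · exact ENNReal.div_ne_top (ENNReal.mul_ne_top (by simp) ENNReal.ofReal_ne_top) h0
  · rw [← ENNReal.add_div, ENNReal.div_self h0 ht]

theorem isProbabilityMeasure_independentAttack [Fintype A] {α : ℝ} (hα : 0 < α)
    (I : Finset Q.Point) : IsProbabilityMeasure (Q.independentAttack α I) := by
  have hvol : (volume (Icc 0 α)) ≠ 0 := by simp [hα]
  have hc : IsProbabilityMeasure (ProbabilityTheory.cond volume (Icc 0 α)) :=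
    ProbabilityTheory.cond_isProbabilityMeasure_of_finite hvol (by simp)
  have hm := Measure.isProbabilityMeasure_map (μ := ProbabilityTheory.cond volume (Icc 0 α))
    measurable_real_toNNReal.aemeasurable
  have hp1 : Q.attackProb α I ≤ 1 := by
    rw [attackProb_coe]
    exact ENNReal.div_le_of_le_mul (by rw [one_mul]; exact le_add_self)
  constructor
  rw [independentAttack, Measure.add_apply, Measure.smul_apply, Measure.smul_apply, smul_eq_mul,
    smul_eq_mul]
  have h1 : Q.attackProb α I * (((ProbabilityTheory.uniformOn (I : Set Q.Point)).prod
      ((ProbabilityTheory.cond volume (Icc 0 α)).map Real.toNNReal)) univ) =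
      Q.attackProb α I := by
    -- For empty `I` the uniform measure is zero, but so is its weight.
    rcases I.eq_empty_or_nonempty with rfl | hI
    · rw [attackProb_coe]; simp
    · have := ProbabilityTheory.isProbabilityMeasure_uniformOn I.finite_toSet hI
      rw [measure_univ, mul_one]
  have h2 : (1 - Q.attackProb α I) *
      (((ProbabilityTheory.cond Q.lengthMeasure (Q.nearSet α I)ᶜ).prod
        (Measure.dirac (Real.toNNReal (α / 2)))) univ) = 1 - Q.attackProb α I := by
    -- Conditioning on a null set gives the zero measure, and the weight `1 - p` then vanishes too.
    by_cases h : Q.lengthMeasure (Q.nearSet α I)ᶜ = 0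
    · rw [one_sub_attackProb hα, h]; simp
    · have := ProbabilityTheory.cond_isProbabilityMeasure h
      rw [measure_univ, mul_one]
  rw [h1, h2, add_tsub_cancel_of_le hp1]

/-- The choice of `p` gives each unit of caught starting time and each unit of covered length of
`Wᶜ` the same weight, the inverse of the denominator. -/
theorem independentAttack_intercepts_le [Fintype A] {α : ℝ} (hα : 0 < α) (I : Finset Q.Point)
    (hI : Q.IsIndependent α I) (S : Q.Patrol) :
    Q.independentAttack α I {a | Q.Intercepts α S a} ≤ ENNReal.ofReal α /
      (Q.lengthMeasure (Q.nearSet α I)ᶜ + I.card * ENNReal.ofReal α) := by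
  classical
  have hm := measurableSet_intercepts_right hα S
  have hvol : volume (Icc 0 α) = ENNReal.ofReal α := by simp
  have ha0 : ENNReal.ofReal α ≠ 0 := by simp [hα]
  have : IsProbabilityMeasure (ProbabilityTheory.cond volume (Icc 0 α)) :=
    ProbabilityTheory.cond_isProbabilityMeasure_of_finite (by simp [hα]) (by simp)
  set c := (I.card : ℝ≥0∞) with hc
  set a := ENNReal.ofReal α with ha
  set w := Q.lengthMeasure (Q.nearSet α I)ᶜ with hw
  set s := ∑ x ∈ I, volume (catchTimes α S x) with hs
  set l := Q.lengthMeasure ((Q.nearSet α I)ᶜ ∩ S.path '' Icc (α / 2) (α / 2 + α)) with hl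
  have h1 : ((ProbabilityTheory.uniformOn (I : Set Q.Point)).prod
      ((ProbabilityTheory.cond volume (Icc 0 α)).map Real.toNNReal)) {a | Q.Intercepts α S a} =
      c⁻¹ * (a⁻¹ * s) := by
    rw [Measure.prod_apply hm, ProbabilityTheory.uniformOn, ProbabilityTheory.cond,
      lintegral_smul_measure, Measure.count_apply_finset, lintegral_finset, smul_eq_mul]
    congr 1
    rw [hs, Finset.mul_sum]
    refine Finset.sum_congr rfl fun x _ => ?_
    rw [Measure.count_singleton, mul_one, Measure.map_apply measurable_real_toNNReal
      (hm.preimage measurable_prodMk_left), ProbabilityTheory.cond_apply measurableSet_Icc, hvol,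
      catchTimes_eq]
    rfl
  have h2 : ((ProbabilityTheory.cond Q.lengthMeasure (Q.nearSet α I)ᶜ).prod
        (Measure.dirac (Real.toNNReal (α / 2)))) {a | Q.Intercepts α S a} = w⁻¹ * l := by
    have hwm : MeasurableSet (Q.nearSet α (I : Set Q.Point))ᶜ :=
      (isClosed_nearSet I.finite_toSet).measurableSet.compl
    rw [Measure.prod_dirac, Measure.map_apply measurable_prodMk_right hm,
      ProbabilityTheory.cond_apply hwm, hl]
    congr 3
    ext x
    simp only [mem_preimage, mem_ofPred_eq, intercepts_iff,
      Real.coe_toNNReal (α / 2) (by positivity), mem_image]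
  have h3 := sum_catchTimes_add_le hα S I hI
  rw [independentAttack, Measure.add_apply, Measure.smul_apply, Measure.smul_apply, smul_eq_mul,
    smul_eq_mul, one_sub_attackProb hα, attackProb_coe, h1, h2]
  set D := w + c * a
  calc c * a / D * (c⁻¹ * (a⁻¹ * s)) + w / D * (w⁻¹ * l)
      = (c * c⁻¹) * ((a * a⁻¹) * (s / D)) + (w * w⁻¹) * (l / D) := by
        simp only [div_eq_mul_inv]; ring
    _ ≤ 1 * (1 * (s / D)) + 1 * (l / D) := by
        -- Only an inequality, since `c` or `w` may be zero.
        gcongr <;> exact ENNReal.mul_inv_le_one _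
    _ = (s + l) / D := by rw [one_mul, one_mul, one_mul, ENNReal.add_div]
    _ ≤ a / D := by gcongr

end Network

/-! ### Separation of visits on a double tour. -/

theorem Cycle.Chain.getElem_mod {β : Type*} {r : β → β → Prop} {l : List β}
    (h : Cycle.Chain r (l : Cycle β)) (hl : 0 < l.length) (i : ℕ) :
    r (l[i % l.length]'(Nat.mod_lt _ hl)) (l[(i + 1) % l.length]'(Nat.mod_lt _ hl)) := by
  cases l with
  | nil => simp at hl
  | cons a l =>
    rw [Cycle.chain_coe_cons, List.isChain_iff_getElem] at h
    have hk := Nat.mod_lt i hl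
    have h1 := h (i % (a :: l).length) (by simpa using hk)
    simp only [← List.cons_append] at h1
    rw [List.getElem_append_left hk] at h1
    have hmod : (i + 1) % (a :: l).length = (i % (a :: l).length + 1) % (a :: l).length := by
      rw [Nat.mod_add_mod]
    simp only [hmod]
    rcases Nat.lt_or_ge (i % (a :: l).length + 1) (a :: l).length with h' | h'
    · rw [List.getElem_append_left h'] at h1
      simpa only [Nat.mod_eq_of_lt h'] using h1
    -- The wrap-around pair of the cycle.
    · have h'' : i % (a :: l).length + 1 = (a :: l).length := by omega
      simp only [h'', List.getElem_concat_length, Nat.mod_self] at h1 ⊢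
      simpa using h1

namespace Network

universe u v

variable {N : Type u} {A : Type v} {Q : Network N A}

theorem le_length_of_le_genGirth {α : ℝ} (hg : ENNReal.ofReal α ≤ Q.genGirth) (C : Q.Circuit) :
    α ≤ C.length := by
  have h1 : ENNReal.ofReal α ≤ ENNReal.ofReal C.length :=
    hg.trans ((min_le_left _ _).trans (iInf_le _ C))
  have h2 : 0 ≤ C.length := List.sum_nonneg fun a ha => by
    obtain ⟨d, -, rfl⟩ := List.mem_map.1 ha
    exact (Q.len_pos _).le
  exact (ENNReal.ofReal_le_ofReal_iff h2).1 h1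

theorem le_two_mul_len_of_le_genGirth {α : ℝ} (hg : ENNReal.ofReal α ≤ Q.genGirth) {e : A}
    (he : Q.IsLeafArc e) : α ≤ 2 * Q.len e := by
  have h1 : ENNReal.ofReal α ≤ ENNReal.ofReal (2 * Q.len e) :=
    hg.trans ((min_le_right _ _).trans (iInf₂_le e he))
  exact (ENNReal.ofReal_le_ofReal_iff (by linarith [Q.len_pos e])).1 h1

/-- Each of the two leaf arcs contributes at least `α / 2` to the distance. -/
theorem isIndependent_leafSet [Finite A] {α : ℝ} (hg : ENNReal.ofReal α ≤ Q.genGirth) :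
    Q.IsIndependent α Q.leafSet := by
  rintro _ ⟨x, hx, rfl⟩ _ ⟨y, hy, rfl⟩ hxy
  obtain ⟨d, rfl⟩ := Q.exists_dart x
  obtain ⟨d', rfl⟩ := Q.exists_dart y
  have h := IsLeaf.len_add_len_le_dist (Q := Q) hx hy (fun h => hxy (by rw [h]))
  have h1 := le_two_mul_len_of_le_genGirth hg (isLeafArc_of_dsrc (Q := Q) hx)
  have h2 := le_two_mul_len_of_le_genGirth hg (isLeafArc_of_dsrc (Q := Q) hy)
  linarith

namespace DoubleTour

variable (T : Q.DoubleTour)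

/-! ### The periodic sequence of darts of a tour -/

/-- The number of steps of the tour. -/
def size : ℕ := T.darts.length

theorem size_pos : 0 < T.size := List.length_pos_of_ne_nil T.ne_nil

/-- The darts of the tour, as a periodic sequence. -/
def dart (i : ℕ) : A × Bool := T.darts[i % T.darts.length]'(Nat.mod_lt _ T.size_pos)

theorem dart_add_size (i : ℕ) : T.dart (i + T.size) = T.dart i := by
  simp only [dart, size, Nat.add_mod_right]
  rfl

theorem dtgt_dart (i : ℕ) : Q.dtgt (T.dart i) = Q.dsrc (T.dart (i + 1)) :=
  T.closed.getElem_mod T.size_pos i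

theorem isLeafArc_of_reversal (i : ℕ)
    (h : T.dart (i + 1) = ((T.dart i).1, !(T.dart i).2)) : Q.IsLeafArc (T.dart i).1 :=
  T.no_reversal.getElem_mod T.size_pos i h

theorem sum_range_dart_eq {M : Type*} [AddCommMonoid M] (ψ : A × Bool → M) :
    ∑ i ∈ Finset.range T.size, ψ (T.dart i) = (T.darts.map ψ).sum := by
  rw [Finset.sum_range, ← Fin.sum_univ_fun_getElem]
  refine Finset.sum_congr rfl fun i _ => ?_
  simp only [dart]
  congr 2
  exact Nat.mod_eq_of_lt i.2

/-- The form in which "every arc exactly twice" is used, for counting visits and for the duration of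
the tour. -/
theorem sum_dart_fst [Fintype A] {M : Type*} [AddCommMonoid M] (φ : A → M) :
    ∑ i ∈ Finset.range T.size, φ (T.dart i).1 = 2 • ∑ e, φ e := by
  classical
  rw [T.sum_range_dart_eq fun d => φ d.1]
  have h := Finset.sum_list_map_count (T.darts.map Prod.fst) φ
  rw [List.map_map] at h
  refine h.trans ?_
  rw [← Finset.sum_nsmul]
  refine (Finset.sum_subset (Finset.subset_univ _) fun e _ he => ?_).trans
    (Finset.sum_congr rfl fun e _ => ?_)
  · rw [List.mem_toFinset] at he
    rw [List.count_eq_zero_of_not_mem he, zero_smul]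
  · congr 1
    convert T.twice e

theorem size_eq [Fintype A] : T.size = 2 * Fintype.card A := by
  simpa using T.sum_dart_fst fun _ => (1 : ℕ)

open Classical in
theorem card_arc_visits [Fintype A] (e : A) :
    ((Finset.range T.size).filter fun i => (T.dart i).1 = e).card = 2 := by
  rw [Finset.card_filter, T.sum_dart_fst fun e' => if e' = e then 1 else 0]
  simp

open Classical in
-- Counting arc ends at `x` along the tour gives twice the degree; it also gives arrivals plus
-- departures, which are equal in number.
theorem card_node_visits [Fintype A] (x : N) :
    ((Finset.range T.size).filter fun i => Q.dtgt (T.dart i) = x).card = Q.degree x := by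
  have h1 := T.sum_dart_fst fun e => (if Q.src e = x then 1 else 0) + if Q.tgt e = x then 1 else 0
  have h2 : ∑ e, ((if Q.src e = x then 1 else 0) + if Q.tgt e = x then 1 else 0) =
      Q.degree x := by
    rw [degree_eq_card, Nat.card_eq_fintype_card, Fintype.card_subtype, Finset.card_filter,
      Fintype.sum_prod_type]
    refine Finset.sum_congr rfl fun e _ => ?_
    rw [Fintype.sum_bool]
    rfl
  have h3 : ∀ d : A × Bool, ((if Q.src d.1 = x then 1 else 0) + if Q.tgt d.1 = x then 1 else 0) =
      (if Q.dsrc d = x then 1 else 0) + if Q.dtgt d = x then 1 else 0 := by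
    rintro ⟨e, b⟩
    cases b
    · exact add_comm _ _
    · rfl
  -- Arrivals are departures one step later, and the sequence is periodic.
  have h4 : ∑ i ∈ Finset.range T.size, (if Q.dtgt (T.dart i) = x then 1 else 0) =
      ∑ i ∈ Finset.range T.size, if Q.dsrc (T.dart i) = x then 1 else 0 := by
    have h5 := Finset.sum_range_succ (fun i => if Q.dsrc (T.dart i) = x then 1 else 0) T.size
    have h6 := Finset.sum_range_succ' (fun i => if Q.dsrc (T.dart i) = x then 1 else 0) T.size
    have h7 : T.dart T.size = T.dart 0 := by simpa using T.dart_add_size 0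
    rw [h7] at h5
    simp only [T.dtgt_dart]
    exact Nat.add_right_cancel (h6.symm.trans h5)
  rw [h2, Finset.sum_congr rfl fun i _ => h3 (T.dart i), Finset.sum_add_distrib, ← h4,
    smul_eq_mul] at h1
  rw [Finset.card_filter]
  omega

/-! ### Times of the tour with pauses -/

/-- The time at which step `i` of the tour with pauses begins. -/
noncomputable def time (α : ℝ) (i : ℕ) : ℝ := ∑ j ∈ Finset.range i, Q.dartTime α (T.dart j)

theorem time_succ (α : ℝ) (i : ℕ) :
    T.time α (i + 1) = T.time α i + Q.dartTime α (T.dart i) := Finset.sum_range_succ _ _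

variable {α : ℝ}

theorem time_mono (hα : 0 < α) : Monotone (T.time α) :=
  monotone_nat_of_le_succ fun i => by
    rw [time_succ]
    linarith [Q.dartTime_pos hα (T.dart i)]

theorem paused_L_eq [Finite A] (hα : 0 < α) : (T.paused α hα).L = T.time α T.size :=
  (T.sum_range_dart_eq (Q.dartTime α)).symm

theorem time_add_size [Finite A] (hα : 0 < α) (i : ℕ) :
    T.time α (i + T.size) = T.time α i + (T.paused α hα).L := by
  rw [T.paused_L_eq hα]
  induction i with
  | zero => simp [time]
  | succ i ih => rw [Nat.add_right_comm, time_succ, ih, time_succ, dart_add_size]; ring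

theorem le_time_sub (hα : 0 < α) {i j k : ℕ} (hik : i ≤ k) (hkj : k < j) :
    Q.dartTime α (T.dart k) ≤ T.time α j - T.time α i := by
  have h1 := T.time_mono hα hik
  have h2 := T.time_mono hα (Nat.succ_le_of_lt hkj)
  rw [Nat.succ_eq_add_one, time_succ] at h2
  linarith

theorem dartTime_of_isLeaf {d : A × Bool} (h : Q.IsLeaf (Q.dtgt d)) :
    Q.dartTime α d = Q.len d.1 + α := by
  rw [dartTime, if_pos h]

end DoubleTour

namespace DoubleTour

variable (T : Q.DoubleTour) {α : ℝ}

/-! ### Closed subwalks take time at least the generalized girth -/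

/-- As long as a start node repeats inside, pass to the shorter closed subwalk between the
repetitions. -/
theorem exists_simple_subwalk (m : ℕ) : ∀ i j : ℕ, i < j → j - i = m →
    Q.dsrc (T.dart i) = Q.dsrc (T.dart j) →
    ∃ i' j', i ≤ i' ∧ i' < j' ∧ j' ≤ j ∧ Q.dsrc (T.dart i') = Q.dsrc (T.dart j') ∧
      ∀ a b, i' ≤ a → a < b → b < j' → Q.dsrc (T.dart a) ≠ Q.dsrc (T.dart b) := by
  induction m using Nat.strong_induction_on with
  | _ m ih =>
    intro i j hij hm h
    by_cases hs : ∀ a b, i ≤ a → a < b → b < j → Q.dsrc (T.dart a) ≠ Q.dsrc (T.dart b)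
    · exact ⟨i, j, le_rfl, hij, le_rfl, h, hs⟩
    · push Not at hs
      obtain ⟨a, b, h1, h2, h3, h4⟩ := hs
      obtain ⟨i', j', h5, h6, h7, h8⟩ := ih (b - a) (by omega) a b h2 rfl h4
      exact ⟨i', j', h1.trans h5, h6, h7.trans h3.le, h8⟩

/-- Repeating an arc in the same direction repeats its start node. In the opposite direction it
repeats the end node, unless the two steps are consecutive; that is a reversal, possible only on a
leaf arc, and hence reaches a leaf node. -/
theorem dart_fst_ne_of_simple {i j : ℕ} (hl : ∀ k, i ≤ k → k < j → ¬ Q.IsLeaf (Q.dtgt (T.dart k)))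
    (hs : ∀ a b, i ≤ a → a < b → b < j → Q.dsrc (T.dart a) ≠ Q.dsrc (T.dart b))
    {a b : ℕ} (ha : i ≤ a) (hab : a < b) (hb : b < j) : (T.dart a).1 ≠ (T.dart b).1 := by
  intro h
  rcases eq_or_eq_reverse h with h | h
  · exact hs a b ha hab hb (by rw [h])
  · have h1 : Q.dsrc (T.dart b) = Q.dsrc (T.dart (a + 1)) := by
      rw [h, dsrc_reverse, T.dtgt_dart]
    have h2 : b = a + 1 := by
      by_contra h2
      exact hs (a + 1) b (by omega) (by omega) hb h1.symm
    subst h2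
    rcases (T.isLeafArc_of_reversal a h).dsrc_or_dtgt with h3 | h3
    · refine hl (a + 1) (by omega) hb ?_
      rwa [h, dtgt_reverse]
    · exact hl a ha (by omega) h3

theorem exists_circuit {i j : ℕ} (hij : i < j) (h : Q.dsrc (T.dart i) = Q.dsrc (T.dart j))
    (hne : ∀ a b, i ≤ a → a < b → b < j → (T.dart a).1 ≠ (T.dart b).1) :
    ∃ C : Q.Circuit, C.length = ∑ k ∈ Finset.Ico i j, Q.len (T.dart k).1 := by
  obtain ⟨n, rfl⟩ : ∃ n, j = i + (n + 1) := ⟨j - i - 1, by omega⟩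
  refine ⟨⟨(List.range (n + 1)).map fun k => T.dart (i + k), by simp, ?_, ?_⟩, ?_⟩
  · have : (((List.range (n + 1)).map fun k => T.dart (i + k) : List (A × Bool)) :
        Cycle (A × Bool)) = (List.range (n + 1) : Cycle ℕ).map fun k => T.dart (i + k) := rfl
    rw [this, Cycle.chain_map, Cycle.chain_range_succ]
    refine ⟨?_, fun m _ => T.dtgt_dart _⟩
    rw [T.dtgt_dart, add_zero, h, add_assoc]
  · rw [List.map_map, List.nodup_map_iff_inj_on List.nodup_range]
    intro a ha b hb hab
    rw [List.mem_range] at ha hb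
    by_contra hne'
    rcases Nat.lt_or_gt_of_ne hne' with h' | h'
    · exact hne (i + a) (i + b) (by omega) (by omega) (by omega) hab
    · exact hne (i + b) (i + a) (by omega) (by omega) (by omega) hab.symm
  · rw [Finset.sum_Ico_eq_sum_range, Circuit.length, List.map_map, Nat.add_sub_cancel_left]
    rw [Finset.sum_eq_multiset_sum]
    rfl

theorem sum_len_le_time_sub (hα : 0 < α) {i j : ℕ} (hij : i ≤ j) :
    ∑ k ∈ Finset.Ico i j, Q.len (T.dart k).1 ≤ T.time α j - T.time α i := by
  rw [time, time, ← Finset.sum_Ico_eq_sub _ hij]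
  exact Finset.sum_le_sum fun k _ => Q.len_le_dartTime hα _

/-- If a leaf node is reached, its pause alone takes `α`. Otherwise a minimal closed subwalk has
distinct arcs, so it is a circuit, of length at least the girth. -/
theorem le_time_sub_of_closed (hα : 0 < α) (hg : ENNReal.ofReal α ≤ Q.genGirth) {i j : ℕ}
    (hij : i < j) (h : Q.dsrc (T.dart i) = Q.dsrc (T.dart j)) :
    α ≤ T.time α j - T.time α i := by
  by_cases hl : ∃ k, i ≤ k ∧ k < j ∧ Q.IsLeaf (Q.dtgt (T.dart k))
  · obtain ⟨k, hik, hkj, hk⟩ := hl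
    have h1 := T.le_time_sub hα hik hkj
    rw [dartTime_of_isLeaf hk] at h1
    linarith [Q.len_pos (T.dart k).1]
  · push Not at hl
    obtain ⟨i', j', h1, h2, h3, h4, h5⟩ := T.exists_simple_subwalk _ i j hij rfl h
    obtain ⟨C, hC⟩ := T.exists_circuit h2 h4 fun a b => T.dart_fst_ne_of_simple
      (fun k hk hk' => hl k (h1.trans hk) (hk'.trans_le h3)) h5
    have h6 := le_length_of_le_genGirth hg C
    have h7 := T.sum_len_le_time_sub hα h2.le
    have h8 := T.time_mono hα h1
    have h9 := T.time_mono hα h3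
    linarith

/-! ### Leaf nodes on the tour -/

/-- The size is even, so a smaller tour means a single arc, and a single arc with a leaf end is the
excluded segment. -/
theorem three_le_size_of_isLeaf [Fintype A] {i : ℕ} (h : Q.IsLeaf (Q.dtgt (T.dart i))) :
    3 ≤ T.size := by
  by_contra hs
  rw [T.size_eq] at hs
  have h1 : Fintype.card A ≤ 1 := by omega
  rw [Fintype.card_le_one_iff] at h1
  refine Q.not_segment ⟨(T.dart i).1, ?_, fun e' => h1 _ _⟩
  rw [← dsrc_reverse] at h
  have h2 := h.dtgt_ne
  rw [dtgt_reverse, dsrc_reverse] at h2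
  generalize T.dart i = d at h2 ⊢
  obtain ⟨e, b⟩ := d
  cases b
  · exact h2.symm
  · exact h2

/-- At a leaf node the tour turns back. -/
theorem dart_succ_of_isLeaf {i : ℕ} (h : Q.IsLeaf (Q.dtgt (T.dart i))) :
    T.dart (i + 1) = ((T.dart i).1, !(T.dart i).2) := by
  rw [← dsrc_reverse] at h
  exact h.dart_unique (by rw [dsrc_reverse, T.dtgt_dart])

theorem dart_mod (i : ℕ) : T.dart (i % T.size) = T.dart i := by
  simp only [dart, size, Nat.mod_mod]
  rfl

theorem mod_eq_of_isLeaf [Fintype A] {i j : ℕ} (h : Q.IsLeaf (Q.dtgt (T.dart i)))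
    (hij : Q.dtgt (T.dart i) = Q.dtgt (T.dart j)) : i % T.size = j % T.size := by
  classical
  have h1 := T.card_node_visits (Q.dtgt (T.dart i))
  have h2 : Q.degree (Q.dtgt (T.dart i)) = 1 := h
  rw [h2] at h1
  exact Finset.card_le_one.1 h1.le _
    (by simp [T.dart_mod, Nat.mod_lt _ T.size_pos]) _
    (by simp [T.dart_mod, Nat.mod_lt _ T.size_pos, hij])

/-- The tour does not traverse a leaf arc from the leaf node and back at once. -/
theorem not_isLeaf_dsrc_of_reversal [Fintype A] {i : ℕ}
    (h : T.dart (i + 1) = ((T.dart i).1, !(T.dart i).2)) : ¬ Q.IsLeaf (Q.dsrc (T.dart i)) := by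
  intro hl
  -- The index `i + T.size - 1` plays the role of `i - 1`. Steps `i - 1` and `i + 1` would both end
  -- at the leaf node, which is reached once per period, so the size would divide `2`.
  have h1 : Q.dtgt (T.dart (i + T.size - 1)) = Q.dsrc (T.dart i) := by
    rw [T.dtgt_dart, Nat.sub_add_cancel (by have := T.size_pos; omega), T.dart_add_size]
  have h2 : Q.dtgt (T.dart (i + 1)) = Q.dsrc (T.dart i) := by rw [h, dtgt_reverse]
  rw [← h1] at h2
  rw [← h1] at hl
  have h3 := T.three_le_size_of_isLeaf hl
  have h4 := T.mod_eq_of_isLeaf hl h2.symm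
  have h5 : i + T.size - 1 = i + 1 + (T.size - 2) := by omega
  rw [h5] at h4
  have h6 : (T.size - 2) % T.size = 0 % T.size :=
    Nat.ModEq.add_left_cancel' (i + 1) (by simpa [Nat.ModEq] using h4)
  rw [Nat.zero_mod, Nat.mod_eq_of_lt (by omega)] at h6
  omega

/-! ### Visits of a point -/

/-- Two visits of an interior point of an arc are at least `α` apart. -/
theorem le_sub_of_interior [Fintype A] (hα : 0 < α) (hg : ENNReal.ofReal α ≤ Q.genGirth) {i j : ℕ}
    (hij : i < j) (h : (T.dart i).1 = (T.dart j).1) {s : ℝ} (hs : s ∈ Ioo 0 (Q.len (T.dart i).1))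
    {c : Bool → ℝ} (hc : c = fun b => if b then s else Q.len (T.dart i).1 - s) :
    T.time α i + c (T.dart i).2 + α ≤ T.time α j + c (T.dart j).2 := by
  obtain ⟨h0, h1⟩ := hs
  -- `c b` is the time from the start of a traversal in direction `b` until the point is passed.
  have hc0 : ∀ b, 0 < c b := by
    intro b; rw [hc]; cases b
    · simp only [Bool.false_eq_true, if_false]; linarith
    · simpa using h0
  have hc1 : ∀ b, c b < Q.len (T.dart i).1 := by
    intro b; rw [hc]; cases b
    · simp only [Bool.false_eq_true, if_false]; linarith
    · simpa using h1
  rcases eq_or_eq_reverse h with h' | h'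
  -- Same direction: the steps from `i` up to `j` form a closed walk.
  · have := T.le_time_sub_of_closed hα hg hij (by rw [h'])
    rw [h']; linarith
  -- Opposite directions: the steps between the two traversals form a closed walk. If there are
  -- none, the tour turns back at a leaf node and the pause provides `α`.
  · have h2 : Q.dsrc (T.dart (i + 1)) = Q.dsrc (T.dart j) := by
      rw [h', dsrc_reverse, T.dtgt_dart]
    have h3 := T.time_succ α i
    have h4 := Q.len_le_dartTime hα (T.dart i)
    have h5 := hc0 (T.dart j).2
    have h6 := hc1 (T.dart i).2
    rcases (Nat.succ_le_of_lt hij).lt_or_eq with h7 | h7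
    · have := T.le_time_sub_of_closed hα hg h7 h2
      simp only [Nat.succ_eq_add_one] at this
      linarith
    · subst h7
      rcases (T.isLeafArc_of_reversal i h').dsrc_or_dtgt with h8 | h8
      · exact absurd h8 (T.not_isLeaf_dsrc_of_reversal h')
      · rw [dartTime_of_isLeaf h8] at h3
        simp only [Nat.succ_eq_add_one] at h5 ⊢
        linarith

end DoubleTour

end Network

/-! ### The Patroller's bound for the randomized tour. -/

theorem volume_le_of_translates_mem {L : ℝ} (hL : 0 < L) {c : ℝ} {J B : Set ℝ}
    (hJ : MeasurableSet J) (hJc : J ⊆ Ioc c (c + L))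
    (hB : ∀ (u : ℝ) (k : ℤ), u + k * L ∈ J → u ∈ B) : volume J ≤ volume (Icc 0 L ∩ B) := by
  let B' : Set ℝ := ⋃ k : ℤ, (fun u => u + k * L) ⁻¹' J
  have hB'm : MeasurableSet B' :=
    MeasurableSet.iUnion fun k => hJ.preimage (measurable_id.add_const _)
  have hinv : ∀ g : AddSubgroup.zmultiples L, (fun x => g +ᵥ x) ⁻¹' B' = B' := by
    rintro ⟨g, m, rfl⟩
    ext u
    simp only [B', mem_preimage, mem_iUnion, AddSubgroup.vadd_def, vadd_eq_add, zsmul_eq_mul]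
    constructor
    · rintro ⟨k, hk⟩
      refine ⟨m + k, ?_⟩
      push_cast
      rwa [show u + (m + k) * L = m * L + u + k * L by ring]
    · rintro ⟨k, hk⟩
      refine ⟨k - m, ?_⟩
      push_cast
      rwa [show m * L + u + (k - m) * L = u + k * L by ring]
  -- The periodic set `B'` has the same measure in any two windows of length `L`, both being
  -- fundamental domains for the translations by multiples of `L`.
  have h := (isAddFundamentalDomain_Ioc hL c).measure_set_eq (isAddFundamentalDomain_Ioc hL 0)
    hB'm hinv
  rw [zero_add] at h
  calc volume J ≤ volume (B' ∩ Ioc c (c + L)) :=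
        measure_mono fun u hu => ⟨mem_iUnion.2 ⟨0, by simpa using hu⟩, hJc hu⟩
    _ = volume (B' ∩ Ioc 0 L) := h
    _ ≤ volume (Icc 0 L ∩ B) := by
        refine measure_mono fun u hu => ⟨Ioc_subset_Icc_self hu.2, ?_⟩
        obtain ⟨k, hk⟩ := mem_iUnion.1 hu.1
        exact hB u k hk

namespace Network

universe u v

variable {N : Type u} {A : Type v} {Q : Network N A}

/-! ### Randomized periodic extensions -/

namespace ClosedPath

variable [Finite A] (P : Q.ClosedPath)

/-- The periodic extension of a closed path to the real line. -/
noncomputable def periodic (u : ℝ) : Q.Point := P.S (P.L * Int.fract (u / P.L))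

theorem periodic_add_int_mul (u : ℝ) (k : ℤ) : P.periodic (u + k * P.L) = P.periodic u := by
  have := P.L_pos.ne'
  rw [periodic, periodic, add_div, mul_div_cancel_right₀ _ this, Int.fract_add_intCast]

theorem periodic_of_mem {u : ℝ} (hu : u ∈ Icc 0 P.L) : P.periodic u = P.S u := by
  have hL := P.L_pos
  rcases hu.2.eq_or_lt with h | h
  · rw [h, periodic, div_self hL.ne', Int.fract_one, mul_zero, P.closed]
  · rw [periodic, Int.fract_eq_self.2 ⟨div_nonneg hu.1 hL.le, (div_lt_one hL).2 h⟩,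
      mul_div_cancel₀ _ hL.ne']

theorem measurable_shift : Measurable P.shift := by
  have hL := P.L_pos.le
  refine Measurable.subtype_mk (measurable_pi_lambda _ fun t => ?_)
  have h1 : Continuous (IccExtend hL ((Icc 0 P.L).domRestrict P.S)) :=
    P.unit_speed.continuousOn.domRestrict.Icc_extend'
  have h2 : (fun Δ => P.shiftFun Δ t) = fun Δ : ℝ =>
      IccExtend hL ((Icc 0 P.L).domRestrict P.S) (P.L * Int.fract (((t : ℝ) + Δ) / P.L)) := by
    funext Δ
    rw [IccExtend_of_mem _ _ ⟨mul_nonneg hL (Int.fract_nonneg _),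
      mul_le_of_le_one_right hL (Int.fract_lt_one _).le⟩]
    rfl
  have h3 : Measurable fun Δ : ℝ => P.L * Int.fract (((t : ℝ) + Δ) / P.L) :=
    (measurable_fract.comp ((measurable_const.add measurable_id).div_const _)).const_mul _
  rw [h2]
  exact h1.measurable.comp h3

instance : IsProbabilityMeasure P.randomizedExtension := by
  have : IsProbabilityMeasure (ProbabilityTheory.cond volume (Icc 0 P.L)) :=
    ProbabilityTheory.cond_isProbabilityMeasure_of_finite (by simp [P.L_pos]) (by simp)
  exact Measure.isProbabilityMeasure_map P.measurable_shift.aemeasurable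

/-- If a closed path is at `x` at two times that are `α` apart in the cyclic order, then its
randomized extension intercepts attacks at `x` with probability at least `2 * α / L`. -/
theorem le_randomizedExtension_intercepts {α t₁ t₂ : ℝ} (hα : 0 < α) (h₁₂ : t₁ + α ≤ t₂)
    (h₂₁ : t₂ + α ≤ t₁ + P.L) {x : Q.Point} (h₁ : P.periodic t₁ = x) (h₂ : P.periodic t₂ = x)
    (τ : ℝ≥0) : ENNReal.ofReal (2 * α / P.L) ≤
      P.randomizedExtension {S | Q.Intercepts α S (x, τ)} := by
  have hL := P.L_pos
  -- The shifts `u` for which `t₁ - u` or `t₂ - u` falls into the attack interval. The two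
  -- separation hypotheses make the intervals disjoint and fit them into one window of length `L`.
  let J : Set ℝ := Ioc (t₁ - τ - α) (t₁ - τ) ∪ Ioc (t₂ - τ - α) (t₂ - τ)
  have hJv : volume J = ENNReal.ofReal (2 * α) := by
    rw [measure_union _ measurableSet_Ioc, Real.volume_Ioc, Real.volume_Ioc, sub_sub_cancel,
      sub_sub_cancel, ← ENNReal.ofReal_add hα.le hα.le, two_mul]
    exact Ioc_disjoint_Ioc_of_le (by linarith)
  have hJB := volume_le_of_translates_mem hL (c := t₁ - τ - α) (J := J)
    (B := P.shift ⁻¹' {S | Q.Intercepts α S (x, τ)})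
    (measurableSet_Ioc.union measurableSet_Ioc)
    (by
      rintro u (hu | hu)
      · exact ⟨hu.1, by linarith [hu.2]⟩
      · exact ⟨by linarith [hu.1], by linarith [hu.2]⟩)
    (by
      intro u k hu
      have key : ∀ t, P.periodic t = x → u + k * P.L ∈ Ioc (t - τ - α) (t - τ) →
          Q.Intercepts α (P.shift u) (x, τ) := by
        intro t ht hu
        have h0 : 0 ≤ t - k * P.L - u := by have := τ.coe_nonneg; linarith [hu.2]
        refine ⟨⟨t - k * P.L - u, h0⟩, ⟨?_, ?_⟩, ?_⟩
        · change (τ : ℝ) ≤ t - k * P.L - u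
          linarith [hu.2]
        · change t - k * P.L - u ≤ τ + α
          linarith [hu.1]
        · change P.periodic (t - k * P.L - u + u) = x
          have := P.periodic_add_int_mul t (-k)
          push_cast at this
          rw [← ht, ← this]
          congr 1; ring
      rcases hu with hu | hu
      · exact key t₁ h₁ hu
      · exact key t₂ h₂ hu)
  refine le_trans ?_ (Measure.le_map_apply P.measurable_shift.aemeasurable _)
  rw [ProbabilityTheory.cond_apply measurableSet_Icc, Real.volume_Icc, sub_zero,
    ENNReal.ofReal_div_of_pos hL, ENNReal.div_eq_inv_mul, ← hJv]
  gcongr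

end ClosedPath

/-! ### Visits of the tour with pauses -/

/-- The value `s = 0` is left out because a switching time is assigned to the preceding dart. -/
theorem pausedWalk_take {α : ℝ} (hα : 0 < α) (ds : List (A × Bool)) :
    ∀ (x : N) (i : ℕ) (hi : i < ds.length), ∀ s ∈ Ioc 0 (Q.dartTime α ds[i]),
      Q.pausedWalk α x ds (((ds.take i).map (Q.dartTime α)).sum + s) = Q.onDart ds[i] s := by
  induction ds with
  | nil => intro x i hi; simp at hi
  | cons d ds ih =>
    intro x i hi s hs
    cases i with
    | zero =>
      rw [pausedWalk, if_pos (by simpa using hs.2)]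
      simp
    | succ i =>
      have h0 : 0 ≤ ((ds.take i).map (Q.dartTime α)).sum := List.sum_nonneg fun a ha => by
        obtain ⟨d, -, rfl⟩ := List.mem_map.1 ha
        exact (Q.dartTime_pos hα d).le
      rw [pausedWalk, List.take_succ_cons, List.map_cons, List.sum_cons,
        if_neg (by linarith [hs.1])]
      rw [show Q.dartTime α d + ((ds.take i).map (Q.dartTime α)).sum + s - Q.dartTime α d =
        ((ds.take i).map (Q.dartTime α)).sum + s by ring]
      exact ih _ i (by simpa using hi) s hs

namespace DoubleTour

variable (T : Q.DoubleTour) {α : ℝ}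

theorem time_eq_sum_take {i : ℕ} (hi : i ≤ T.size) :
    T.time α i = ((T.darts.take i).map (Q.dartTime α)).sum := by
  induction i with
  | zero => simp [time]
  | succ i ih =>
    have hi' : i < T.darts.length := hi
    rw [time_succ, ih (by omega), List.take_succ_eq_append_getElem hi', List.map_append,
      List.sum_append]
    simp [dart, Nat.mod_eq_of_lt hi']

theorem periodic_time_add [Finite A] (hα : 0 < α) (i : ℕ) {s : ℝ}
    (hs : s ∈ Ioc 0 (Q.dartTime α (T.dart i))) :
    (T.paused α hα).periodic (T.time α i + s) = Q.onDart (T.dart i) s := by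
  induction i using Nat.strong_induction_on with
  | _ i ih =>
    rcases Nat.lt_or_ge i T.size with hi | hi
    · have hd : T.dart i = T.darts[i]'hi := by
        simp only [dart, Nat.mod_eq_of_lt (show i < T.darts.length from hi)]
        rfl
      rw [ClosedPath.periodic_of_mem]
      · rw [T.time_eq_sum_take hi.le, hd]
        exact pausedWalk_take hα T.darts _ i hi s (hd ▸ hs)
      · have h1 := T.time_mono hα (Nat.zero_le i)
        have h2 := T.time_mono hα (Nat.succ_le_of_lt hi)
        rw [← T.paused_L_eq hα, Nat.succ_eq_add_one, time_succ] at h2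
        have h3 : T.time α 0 = 0 := by simp [time]
        exact ⟨by linarith [hs.1], by linarith [hs.2]⟩
    · obtain ⟨j, rfl⟩ : ∃ j, i = j + T.size := ⟨i - T.size, by omega⟩
      rw [T.dart_add_size] at hs ⊢
      rw [← ih j (by have := T.size_pos; omega) hs, T.time_add_size hα]
      have := (T.paused α hα).periodic_add_int_mul (T.time α j + s) 1
      rw [← this]
      congr 1
      push_cast; ring

theorem periodic_time_succ [Finite A] (hα : 0 < α) (i : ℕ) :
    (T.paused α hα).periodic (T.time α (i + 1)) = .node (Q.dtgt (T.dart i)) := by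
  rw [T.time_succ, T.periodic_time_add hα i ⟨Q.dartTime_pos hα _, le_rfl⟩,
    Q.onDart_of_ge _ (Q.len_le_dartTime hα _)]

/-- The two traversals of the arc are separated by `le_sub_of_interior`, applied from the first to
the second and from the second to the first in the next period. -/
theorem exists_visits_interior [Fintype A] (hα : 0 < α) (hg : ENNReal.ofReal α ≤ Q.genGirth)
    {e : A} {s : ℝ} (hs : s ∈ Ioo 0 (Q.len e)) :
    ∃ t₁ t₂, t₁ + α ≤ t₂ ∧ t₂ + α ≤ t₁ + (T.paused α hα).L ∧
      (T.paused α hα).periodic t₁ = Q.onArc e s ∧ (T.paused α hα).periodic t₂ = Q.onArc e s := by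
  classical
  have h2 := T.card_arc_visits e
  obtain ⟨a, ha, b, hb, hab⟩ := Finset.one_lt_card.1 (by rw [h2]; exact one_lt_two)
  simp only [Finset.mem_filter, Finset.mem_range] at ha hb
  wlog hlt : a < b generalizing a b
  · exact this b a hab.symm hb ha (by omega)
  let c : Bool → ℝ := fun b => if b then s else Q.len e - s
  have hpos : ∀ i, (T.dart i).1 = e →
      (T.paused α hα).periodic (T.time α i + c (T.dart i).2) = Q.onArc e s := by
    intro i hi
    have hle := Q.len_le_dartTime hα (T.dart i)
    rw [T.periodic_time_add hα]
    · generalize T.dart i = d at hi ⊢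
      obtain ⟨e', b⟩ := d
      obtain rfl : e' = e := hi
      cases b <;> simp [onDart, c]
    · rw [hi] at hle
      obtain ⟨h0, h1⟩ := hs
      cases (T.dart i).2
      · simp only [c, Bool.false_eq_true, if_false]
        exact ⟨by linarith, by linarith⟩
      · simp only [c, if_true]
        exact ⟨h0, by linarith⟩
  have g1 := T.le_sub_of_interior hα hg hlt (ha.2.trans hb.2.symm) (s := s) (c := c)
    (by rw [ha.2]; exact hs) (by rw [ha.2])
  have g2 := T.le_sub_of_interior hα hg (show b < a + T.size by omega)
    (by rw [T.dart_add_size, ha.2, hb.2]) (s := s) (c := c)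
    (by rw [hb.2]; exact hs) (by rw [hb.2])
  rw [T.dart_add_size, T.time_add_size hα] at g2
  exact ⟨_, _, g1, by linarith, hpos a ha.2, hpos b hb.2⟩

/-- At a leaf node, the beginning and the end of the pause serve; the period is at least `2 * α`, as
it includes the pause and both traversals of the leaf arc, together of length at least `α`. Any
other node is reached at least twice, and the steps between arrivals form closed walks. -/
theorem exists_visits_node [Fintype A] (hα : 0 < α) (hg : ENNReal.ofReal α ≤ Q.genGirth) (x : N) :
    ∃ t₁ t₂, t₁ + α ≤ t₂ ∧ t₂ + α ≤ t₁ + (T.paused α hα).L ∧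
      (T.paused α hα).periodic t₁ = .node x ∧ (T.paused α hα).periodic t₂ = .node x := by
  classical
  have hd := T.card_node_visits x
  by_cases hx : Q.IsLeaf x
  · have h1 : Q.degree x = 1 := hx
    obtain ⟨a, ha⟩ := Finset.card_pos.1 (by rw [hd, h1]; exact one_pos)
    simp only [Finset.mem_filter, Finset.mem_range] at ha
    obtain ⟨-, rfl⟩ := ha
    have h2 := T.dart_succ_of_isLeaf hx
    have h3 := T.three_le_size_of_isLeaf hx
    have h4 := le_two_mul_len_of_le_genGirth hg (isLeafArc_of_dtgt hx)
    have h5 := T.time_add_size hα a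
    have h6 := T.time_mono hα (show a + 1 + 1 ≤ a + T.size by omega)
    have h7 := Q.len_le_dartTime hα (T.dart (a + 1))
    have h8 := Q.len_pos (T.dart a).1
    rw [T.time_succ, T.time_succ, dartTime_of_isLeaf hx] at h6
    rw [h2] at h6 h7
    refine ⟨T.time α a + Q.len (T.dart a).1, T.time α (a + 1), ?_, ?_, ?_,
      T.periodic_time_succ hα a⟩
    · rw [T.time_succ, dartTime_of_isLeaf hx, add_assoc]
    · rw [T.time_succ, dartTime_of_isLeaf hx]; linarith
    · rw [T.periodic_time_add hα a ⟨h8, Q.len_le_dartTime hα _⟩, Q.onDart_of_ge _ le_rfl]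
  · obtain ⟨a, ha, b, hb, hab⟩ := Finset.one_lt_card.1 (by
      rw [hd]; exact two_le_degree hx)
    simp only [Finset.mem_filter, Finset.mem_range] at ha hb
    wlog hlt : a < b generalizing a b
    · exact this b a hab.symm hb ha (by omega)
    have g1 := T.le_time_sub_of_closed hα hg (show a + 1 < b + 1 by omega)
      (by rw [← T.dtgt_dart, ← T.dtgt_dart, ha.2, hb.2])
    have g2 := T.le_time_sub_of_closed hα hg (show b + 1 < a + 1 + T.size by omega)
      (by rw [T.dart_add_size, ← T.dtgt_dart, ← T.dtgt_dart, ha.2, hb.2])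
    rw [T.time_add_size hα] at g2
    refine ⟨T.time α (a + 1), T.time α (b + 1), by linarith, by linarith, ?_, ?_⟩
    · rw [T.periodic_time_succ, ha.2]
    · rw [T.periodic_time_succ, hb.2]

theorem exists_visits [Fintype A] (hα : 0 < α) (hg : ENNReal.ofReal α ≤ Q.genGirth)
    (x : Q.Point) : ∃ t₁ t₂, t₁ + α ≤ t₂ ∧ t₂ + α ≤ t₁ + (T.paused α hα).L ∧
      (T.paused α hα).periodic t₁ = x ∧ (T.paused α hα).periodic t₂ = x := by
  cases x with
  | node x => exact T.exists_visits_node hα hg x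
  | interior e s h0 h1 =>
    rw [← Q.onArc_of_mem e h0 h1]
    exact T.exists_visits_interior hα hg ⟨h0, h1⟩

/-- Every arc is traversed twice and every leaf node, having degree one, is reached once. -/
theorem paused_L [Fintype N] [Fintype A] (hα : 0 < α) :
    (T.paused α hα).L = 2 * Q.totalLength + Q.leafSet.ncard * α := by
  classical
  have h1 : ∀ d : A × Bool, Q.dartTime α d =
      Q.len d.1 + ∑ x ∈ Finset.univ.filter fun x => Q.IsLeaf x, if Q.dtgt d = x then α else 0 := by
    intro d
    rw [dartTime, Finset.sum_ite_eq]
    simp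
  have h2 : Q.leafSet.ncard = (Finset.univ.filter fun x => Q.IsLeaf x).card := by
    rw [leafSet, Set.ncard_image_of_injective _ fun x y h => by injection h,
      ← Set.ncard_coe_finset]
    congr 1
    ext x
    simp
  rw [T.paused_L_eq hα, time, Finset.sum_congr rfl fun i _ => h1 (T.dart i),
    Finset.sum_add_distrib, T.sum_dart_fst Q.len, totalLength_eq, Finset.sum_comm, h2, nsmul_eq_mul]
  congr 1
  rw [← nsmul_eq_mul]
  refine Finset.sum_eq_card_nsmul fun x hx => ?_
  have hx' : Q.degree x = 1 := (Finset.mem_filter.1 hx).2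
  rw [← Finset.sum_filter, Finset.sum_const, T.card_node_visits x, hx', one_smul]

end DoubleTour

end Network

/-! ### Existence of double tours, and the value of the game. -/

theorem Cycle.chain_coe_iff {β : Type*} {r : β → β → Prop} {l : List β} :
    Cycle.Chain r (l : Cycle β) ↔
      l.IsChain r ∧ ∀ x ∈ l.getLast?, ∀ y ∈ l.head?, r x y := by
  cases l with
  | nil => simp
  | cons a l =>
    rw [Cycle.chain_coe_cons, ← List.cons_append, List.isChain_append]
    simp

/-- A cyclic rotation has no fixed point on two or more elements. -/
theorem Finite.exists_perm_of_fixed_imp_card_eq_one (X : Type*) [Finite X] :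
    ∃ p : Equiv.Perm X, ∀ x, p x = x → Nat.card X = 1 := by
  obtain ⟨n, ⟨f⟩⟩ := Finite.exists_equiv_fin X
  refine ⟨(f.trans (finRotate n)).trans f.symm, fun x hx => ?_⟩
  rw [Nat.card_congr f, Nat.card_eq_fintype_card, Fintype.card_fin]
  rw [Equiv.trans_apply, Equiv.trans_apply, Equiv.symm_apply_eq] at hx
  generalize f x = i at hx
  match n, i with
  | 1, _ => rfl
  | n + 2, i =>
    rw [finRotate_apply] at hx
    simp at hx

/-- A map all of whose fibres are finite admits a permutation of its domain that preserves the
fibres and fixes points of singleton fibres only. -/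
theorem exists_perm_of_fibers {X Y : Type*} [Finite X] (g : X → Y) :
    ∃ p : Equiv.Perm X, (∀ x, g (p x) = g x) ∧
      ∀ x, p x = x → Nat.card {x' // g x' = g x} = 1 := by
  choose p hp using fun y => Finite.exists_perm_of_fixed_imp_card_eq_one {x // g x = y}
  refine ⟨(Equiv.sigmaFiberEquiv g).permCongr (Equiv.sigmaCongrRight p), fun x => ?_,
    fun x hx => ?_⟩
  · exact (p (g x) ⟨x, rfl⟩).2
  · exact hp (g x) ⟨x, rfl⟩ (Subtype.ext hx)

/-- A permutation of a finite type decomposes into cyclic lists. -/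
theorem Equiv.Perm.exists_cycle_lists {X : Type*} [Fintype X] (p : Equiv.Perm X) :
    ∃ F : Multiset (List X), (∀ l ∈ F, l ≠ [] ∧ Cycle.Chain (fun a b => b = p a) (l : Cycle X)) ∧
      F.bind (fun l => (l : Multiset X)) = (Finset.univ : Finset X).val := by
  classical
  have hper : ∀ x, x ∈ Function.periodicPts p := fun x =>
    Function.Injective.mem_periodicPts p.injective x
  let s := Equiv.Perm.SameCycle.setoid p
  -- The orbit of `x`, each element listed once; one representative is then taken from each cycle
  -- class.
  let L : X → List X := fun x => (List.range (Function.minimalPeriod p x)).map fun n => p^[n] x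
  have hL : ∀ x, (L x : Cycle X) = Function.periodicOrbit p x := fun x => rfl
  have hmem : ∀ x y, y ∈ L x ↔ p.SameCycle x y := by
    intro x y
    rw [← Cycle.mem_coe_iff, hL, Function.mem_periodicOrbit_iff (hper x)]
    constructor
    · rintro ⟨n, rfl⟩
      exact ⟨n, by simp [Equiv.Perm.iterate_eq_pow]⟩
    · intro h
      obtain ⟨n, -, hn⟩ := h.exists_pow_eq'
      exact ⟨n, by rw [Equiv.Perm.iterate_eq_pow, hn]⟩
  have hnd : ∀ x, (L x).Nodup := fun x => by
    rw [← Cycle.nodup_coe_iff, hL]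
    exact Function.nodup_periodicOrbit
  refine ⟨(Finset.univ : Finset (Quotient s)).val.map fun q => L q.out, fun l hl => ?_, ?_⟩
  · obtain ⟨q, -, rfl⟩ := Multiset.mem_map.1 hl
    refine ⟨List.ne_nil_of_mem ((hmem _ _).2 (Equiv.Perm.SameCycle.refl p q.out)), ?_⟩
    rw [hL, Function.periodicOrbit_chain' _ (hper _)]
    intro n
    rw [Function.iterate_succ_apply']
  · ext x
    rw [Multiset.bind_map, Multiset.count_bind, Multiset.count_eq_one_of_mem Finset.univ.nodup
      (Finset.mem_univ x)]
    change ∑ q : Quotient s, Multiset.count x (L q.out : Multiset X) = 1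
    rw [Finset.sum_eq_single_of_mem (⟦x⟧ : Quotient s) (Finset.mem_univ _)]
    · exact Multiset.count_eq_one_of_mem (hnd _) ((hmem _ _).2 (Quotient.mk_out (s := s) x))
    · intro q _ hq
      refine Multiset.count_eq_zero_of_notMem fun h => hq ?_
      rw [← Quotient.out_eq q]
      exact Quotient.sound ((hmem _ _).1 h)

theorem List.exists_isRotated_head {β : Type*} {l : List β} {a : β} (h : a ∈ l) :
    ∃ l', (a :: l') ~r l := by
  obtain ⟨s, t, rfl⟩ := List.append_of_mem h
  refine ⟨t ++ s, ?_⟩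
  exact (List.isRotated_append (l := s) (l' := a :: t)).symm

namespace Network

universe u v

variable {N : Type u} {A : Type v} {Q : Network N A}

/-! ### Existence of double tours -/

/-- The dart `d'` may follow the dart `d` in a tour. -/
def Follows (Q : Network N A) (d d' : A × Bool) : Prop :=
  Q.dtgt d = Q.dsrc d' ∧ (d' = (d.1, !d.2) → Q.IsLeafArc d.1)

/-- The reverse of a dart. -/
def reverse (d : A × Bool) : A × Bool := (d.1, !d.2)

@[simp] theorem reverse_reverse (d : A × Bool) : reverse (reverse d) = d := by
  simp [reverse]

theorem reverse_ne (d : A × Bool) : reverse d ≠ d := by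
  intro h
  have := congrArg Prod.snd h
  simp [reverse] at this

theorem Follows.reverse {d d' : A × Bool} (h : Q.Follows d d') :
    Q.Follows (reverse d') (reverse d) := by
  refine ⟨?_, fun h' => ?_⟩
  · rw [Network.reverse, Network.reverse, dtgt_reverse, dsrc_reverse, h.1]
  · have h1 : Network.reverse d = d' := h'.trans (reverse_reverse d')
    have := h.2 h1.symm
    rwa [← h1]

theorem two_le_count_of_getLast {a z : A × Bool} {l : List (A × Bool)} {e : A} [DecidableEq A]
    (hz : z ∈ (a :: l).getLast?) (h : a ≠ z) (ha : a.1 = e) (hze : z.1 = e) :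
    2 ≤ ((a :: l).map Prod.fst).count e := by
  have hz' : z ∈ a :: l := List.mem_of_mem_getLast? hz
  have hz'' : z ∈ l := (List.mem_cons.1 hz').resolve_left h.symm
  rw [List.map_cons, ha, List.count_cons_self]
  have : 0 < (l.map Prod.fst).count e :=
    List.count_pos_iff.2 (hze ▸ List.mem_map_of_mem hz'')
  omega

/-- Two closed walks that meet can be joined, if they traverse no arc more than twice together. -/
theorem exists_merge [DecidableEq A] {a₁ a₂ : A × Bool} {l₁ l₂ : List (A × Bool)}
    (h₁ : Cycle.Chain Q.Follows (↑(a₁ :: l₁) : Cycle (A × Bool)))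
    (h₂ : Cycle.Chain Q.Follows (↑(a₂ :: l₂) : Cycle (A × Bool)))
    (h : Q.dsrc a₁ = Q.dsrc a₂)
    (hc : ∀ e, ((a₁ :: l₁).map Prod.fst).count e + ((a₂ :: l₂).map Prod.fst).count e ≤ 2) :
    ∃ l : List (A × Bool), l ≠ [] ∧ Cycle.Chain Q.Follows (l : Cycle (A × Bool)) ∧
      (l.map Prod.fst).Perm ((a₁ :: l₁).map Prod.fst ++ (a₂ :: l₂).map Prod.fst) := by
  rw [Cycle.chain_coe_iff] at h₁ h₂
  obtain ⟨z₁, hz₁⟩ : ∃ z, z ∈ (a₁ :: l₁).getLast? := ⟨_, List.getLast_mem_getLast? (by simp)⟩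
  obtain ⟨z₂, hz₂⟩ : ∃ z, z ∈ (a₂ :: l₂).getLast? := ⟨_, List.getLast_mem_getLast? (by simp)⟩
  have f₁ := (h₁.2 z₁ hz₁ a₁ rfl).1
  have f₂ := (h₂.2 z₂ hz₂ a₂ rfl).1
  have c₁ : ∀ {d : A × Bool}, d ∈ a₁ :: l₁ → 0 < ((a₁ :: l₁).map Prod.fst).count d.1 :=
    fun hd => List.count_pos_iff.2 (List.mem_map_of_mem hd)
  have c₂ : ∀ {d : A × Bool}, d ∈ a₂ :: l₂ → 0 < ((a₂ :: l₂).map Prod.fst).count d.1 :=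
    fun hd => List.count_pos_iff.2 (List.mem_map_of_mem hd)
  have m₁ := List.mem_of_mem_getLast? hz₁
  have m₂ := List.mem_of_mem_getLast? hz₂
  -- In this case plain concatenation would create a reversal at a junction, so the second walk is
  -- inserted backwards.
  by_cases hb : a₂ = reverse z₁ ∨ a₁ = reverse z₂
  -- The backward insertion could create a reversal only if `z₁ = z₂` or `a₁ = a₂`; together with
  -- `hb`, either would make some arc occur three times.
  · have hb' : z₁ ≠ z₂ ∧ a₁ ≠ a₂ := by
      constructor
      · rintro rfl
        have := hc z₁.1
        rcases hb with rfl | rfl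
        · have := two_le_count_of_getLast hz₂ (e := z₁.1) (reverse_ne z₁) rfl rfl
          have := c₁ m₁
          omega
        · have := two_le_count_of_getLast hz₁ (e := z₁.1) (reverse_ne z₁) rfl rfl
          have := c₂ m₂
          omega
      · rintro rfl
        have := hc a₁.1
        rcases hb with hb | hb
        · have := two_le_count_of_getLast hz₁ (e := a₁.1) (by rw [hb]; exact reverse_ne z₁) rfl
            (by rw [hb]; rfl)
          have := c₂ (List.mem_cons_self (a := a₁) (l := l₂))
          omega
        · have := two_le_count_of_getLast hz₂ (e := a₁.1) (by rw [hb]; exact reverse_ne z₂) rfl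
            (by rw [hb]; rfl)
          have := c₁ (List.mem_cons_self (a := a₁) (l := l₁))
          omega
    have hrl : ((a₂ :: l₂).map reverse).reverse.getLast? = some (reverse a₂) := by simp
    have hrh : ((a₂ :: l₂).map reverse).reverse.head? = some (reverse z₂) := by
      rw [List.head?_reverse, List.getLast?_map, Option.mem_def.1 hz₂]; rfl
    refine ⟨(a₁ :: l₁) ++ ((a₂ :: l₂).map reverse).reverse, by simp, ?_, ?_⟩
    · rw [Cycle.chain_coe_iff, List.isChain_append]
      refine ⟨⟨h₁.1, ?_, ?_⟩, ?_⟩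
      · rw [List.isChain_reverse, List.isChain_map]
        exact h₂.1.imp fun _ _ h => h.reverse
      · intro x hx y hy
        rw [hrh] at hy
        obtain rfl := Option.some.inj (hz₁.symm.trans hx)
        obtain rfl := Option.some.inj hy
        refine ⟨?_, fun h' => absurd ?_ hb'.1⟩
        · rw [reverse, dsrc_reverse, f₁, f₂, h]
        · have : reverse (reverse z₂) = reverse (reverse z₁) := congrArg reverse h'
          simpa using this.symm
      · intro x hx y hy
        rw [List.getLast?_append, hrl] at hx
        obtain rfl : reverse a₂ = x := by simpa using hx
        obtain rfl : a₁ = y := by simpa using hy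
        refine ⟨?_, fun h' => absurd ?_ hb'.2⟩
        · rw [reverse, dtgt_reverse, h]
        · exact h'.trans (reverse_reverse a₂)
    · rw [List.map_append]
      refine List.Perm.append_left _ ?_
      rw [List.map_reverse]
      refine (List.reverse_perm _).trans ?_
      rw [List.map_map]
      rfl
  · push Not at hb
    refine ⟨(a₁ :: l₁) ++ (a₂ :: l₂), by simp, ?_, by rw [List.map_append]⟩
    rw [Cycle.chain_coe_iff, List.isChain_append]
    refine ⟨⟨h₁.1, h₂.1, ?_⟩, ?_⟩
    · intro x hx y hy
      obtain rfl := Option.some.inj (hz₁.symm.trans hx)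
      obtain rfl : a₂ = y := by simpa using hy
      exact ⟨f₁.trans h, fun h' => absurd h' hb.1⟩
    · intro x hx y hy
      rw [List.getLast?_append, Option.mem_def.1 hz₂] at hx
      obtain rfl : z₂ = x := by simpa using hx
      obtain rfl : a₁ = y := by simpa using hy
      exact ⟨f₂.trans h.symm, fun h' => absurd h' hb.2⟩

/-- A family of closed walks without reversals that traverses every arc exactly twice. -/
structure IsDoubleCover [DecidableEq A] (Q : Network N A)
    (F : Multiset (List (A × Bool))) : Prop where
  ne_nil : ∀ l ∈ F, l ≠ []
  chain : ∀ l ∈ F, Cycle.Chain Q.Follows (l : Cycle (A × Bool))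
  twice : ∀ e, (F.bind fun l => (l.map Prod.fst : Multiset A)).count e = 2

/-- After arriving by `d`, leave by `σ (reverse d)`, where `σ` permutes the darts starting at each
node and fixes a dart only at a leaf node. The cycles of this permutation use each of the two darts
of an arc once. -/
theorem exists_isDoubleCover [Finite A] [DecidableEq A] (Q : Network N A) :
    ∃ F, Q.IsDoubleCover F := by
  have := Fintype.ofFinite A
  obtain ⟨σ, h1, h2⟩ := exists_perm_of_fibers Q.dsrc
  let r : Equiv.Perm (A × Bool) := Function.Involutive.toPerm reverse reverse_reverse
  obtain ⟨F, hF, hu⟩ := Equiv.Perm.exists_cycle_lists (r.trans σ)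
  refine ⟨F, fun l hl => (hF l hl).1, fun l hl => (hF l hl).2.imp ?_, fun e => ?_⟩
  · rintro a _ rfl
    refine ⟨?_, fun h => ?_⟩
    · change _ = Q.dsrc (σ (reverse a))
      rw [h1, reverse, dsrc_reverse]
    · have h3 : Q.IsLeaf (Q.dsrc (reverse a)) := h2 (reverse a) h
      exact isLeafArc_of_dsrc (d := reverse a) h3
  · have h3 : (F.bind fun l => (l.map Prod.fst : Multiset A)) =
        (Finset.univ : Finset (A × Bool)).val.map Prod.fst := by
      rw [← hu, Multiset.map_bind]
      rfl
    rw [h3, Multiset.count_map]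
    change (Finset.univ.filter fun d : A × Bool => e = d.1).card = 2
    rw [Finset.card_filter, Fintype.sum_prod_type, Finset.sum_eq_single_of_mem e
      (Finset.mem_univ e) fun e' _ he' => by simp [he'.symm]]
    simp

theorem mem_ends_of_mem {l : List (A × Bool)}
    (hl : Cycle.Chain Q.Follows (l : Cycle (A × Bool))) {d : A × Bool} (hd : d ∈ l) :
    ∃ d' ∈ l, Q.dsrc d' = Q.dtgt d := by
  obtain ⟨i, hi, rfl⟩ := List.getElem_of_mem hd
  have h0 : 0 < l.length := by omega
  have := hl.getElem_mod h0 i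
  simp only [Nat.mod_eq_of_lt hi] at this
  exact ⟨_, List.getElem_mem _, this.1.symm⟩

/-- The walks of a double cover are linked to each other. -/
theorem IsDoubleCover.exists_meet [DecidableEq A] {l₁ : List (A × Bool)}
    {F : Multiset (List (A × Bool))} (h : Q.IsDoubleCover (l₁ ::ₘ F)) (hF : F ≠ 0) :
    ∃ l₂ ∈ F, ∃ d₁ ∈ l₁, ∃ d₂ ∈ l₂, Q.dsrc d₁ = Q.dsrc d₂ := by
  by_contra! hno
  obtain ⟨d₀, hd₀⟩ := List.exists_mem_of_ne_nil _ (h.ne_nil l₁ (Multiset.mem_cons_self _ _))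
  -- If `l₁` meets no other walk, its nodes are closed under passing along arcs: an arc at such a
  -- node occurs in some walk, which contains both its ends and so must be `l₁`.
  have hall := mem_of_closed (Q := Q) (X := {x | ∃ d ∈ l₁, Q.dsrc d = x}) (by
    rintro d ⟨d₁, hd₁, hd⟩
    obtain ⟨l, hl, d', hd', he⟩ : ∃ l ∈ l₁ ::ₘ F, ∃ d' ∈ l, d.1 = d'.1 := by
      have : d.1 ∈ (l₁ ::ₘ F).bind fun l => (l.map Prod.fst : Multiset A) := by
        rw [← Multiset.count_pos, h.twice]; exact two_pos
      obtain ⟨l, hl, hdl⟩ := Multiset.mem_bind.1 this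
      obtain ⟨d', hd', he⟩ := List.mem_map.1 (Multiset.mem_coe.1 hdl)
      exact ⟨l, hl, d', hd', he.symm⟩
    have hends : ∃ d₂ ∈ l, ∃ d₃ ∈ l, Q.dsrc d₂ = Q.dsrc d ∧ Q.dsrc d₃ = Q.dtgt d := by
      obtain ⟨d'', hd'', hs⟩ := mem_ends_of_mem (h.chain l hl) hd'
      rcases eq_or_eq_reverse he with rfl | h'
      · exact ⟨d', hd', d'', hd'', rfl, hs⟩
      · rw [h', dtgt_reverse] at hs
        exact ⟨d'', hd'', d', hd', hs, by rw [h', dsrc_reverse]⟩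
    obtain ⟨d₂, hd₂, d₃, hd₃, hs, ht⟩ := hends
    rcases Multiset.mem_cons.1 hl with rfl | hl
    · exact ⟨d₃, hd₃, ht⟩
    · exact absurd (hd.trans hs.symm) (hno l hl d₁ hd₁ d₂ hd₂)) ⟨d₀, hd₀, rfl⟩
  obtain ⟨l, hl⟩ := Multiset.exists_mem_of_ne_zero hF
  obtain ⟨d₂, hd₂⟩ := List.exists_mem_of_ne_nil _ (h.ne_nil l (Multiset.mem_cons_of_mem hl))
  obtain ⟨d₁, hd₁, hs⟩ := hall (Q.dsrc d₂)
  exact hno l hl d₁ hd₁ d₂ hd₂ hs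

/-- Two walks that meet are rotated to start at a common node and merged, so the new cover has one
walk fewer. -/
theorem IsDoubleCover.exists_card_eq [DecidableEq A] {l₁ : List (A × Bool)}
    {F : Multiset (List (A × Bool))} (h : Q.IsDoubleCover (l₁ ::ₘ F)) (hF : F ≠ 0) :
    ∃ F', Q.IsDoubleCover F' ∧ F'.card = F.card := by
  obtain ⟨l₂, hl₂, d₁, hd₁, d₂, hd₂, hs⟩ := h.exists_meet hF
  obtain ⟨G, rfl⟩ := Multiset.exists_cons_of_mem hl₂
  obtain ⟨k₁, hk₁⟩ := List.exists_isRotated_head hd₁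
  obtain ⟨k₂, hk₂⟩ := List.exists_isRotated_head hd₂
  have htw := h.twice
  simp only [Multiset.cons_bind, Multiset.count_add, Multiset.coe_count] at htw
  have p₁ := hk₁.perm.map Prod.fst
  have p₂ := hk₂.perm.map Prod.fst
  have e₁ : (↑(d₁ :: k₁) : Cycle (A × Bool)) = l₁ := Cycle.coe_eq_coe.2 hk₁
  have e₂ : (↑(d₂ :: k₂) : Cycle (A × Bool)) = l₂ := Cycle.coe_eq_coe.2 hk₂
  obtain ⟨l, hl0, hlc, hlp⟩ := exists_merge (Q := Q) (a₁ := d₁) (a₂ := d₂) (l₁ := k₁) (l₂ := k₂)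
    (e₁ ▸ h.chain l₁ (by simp)) (e₂ ▸ h.chain l₂ (by simp)) hs fun e => by
      rw [p₁.count_eq, p₂.count_eq]
      have := htw e
      omega
  refine ⟨l ::ₘ G, ⟨?_, ?_, ?_⟩, by simp⟩
  · intro l' hl'
    rcases Multiset.mem_cons.1 hl' with rfl | hl'
    · exact hl0
    · exact h.ne_nil l' (by simp [hl'])
  · intro l' hl'
    rcases Multiset.mem_cons.1 hl' with rfl | hl'
    · exact hlc
    · exact h.chain l' (by simp [hl'])
  · intro e
    rw [Multiset.cons_bind, Multiset.count_add, Multiset.coe_count, hlp.count_eq,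
      List.count_append, p₁.count_eq, p₂.count_eq, add_assoc]
    exact htw e

theorem nonempty_doubleTour [Finite A] (Q : Network N A) : Nonempty Q.DoubleTour := by
  classical
  obtain ⟨F, hF⟩ := Q.exists_isDoubleCover
  obtain ⟨n, hn⟩ : ∃ n, F.card = n := ⟨_, rfl⟩
  induction n generalizing F with
  | zero =>
    rw [Multiset.card_eq_zero] at hn
    subst hn
    obtain ⟨e⟩ := Q.arc_nonempty
    simpa using hF.twice e
  | succ n ih =>
    obtain ⟨l, hl⟩ := Multiset.card_pos_iff_exists_mem.1 (by omega : 0 < F.card)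
    obtain ⟨G, rfl⟩ := Multiset.exists_cons_of_mem hl
    by_cases hG : G = 0
    · subst hG
      have hc := hF.chain l (by simp)
      refine ⟨⟨l, hc.imp fun _ _ h => h.1, fun e => ?_, hc.imp fun _ _ h => h.2⟩⟩
      have := hF.twice e
      simp only [Multiset.cons_bind, Multiset.zero_bind, add_zero, Multiset.coe_count] at this
      convert this
    · obtain ⟨F', hF', hc⟩ := hF.exists_card_eq hG
      exact ih F' hF' (by rw [hc]; simpa using hn)

/-! ### Optimality -/

/-- By Fubini it suffices to consider pure attacks. -/
theorem le_patrolGuarantee [Finite A] {α : ℝ} (hα : 0 < α) {σ : Measure Q.Patrol}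
    [IsProbabilityMeasure σ] {V : ℝ≥0∞} (h : ∀ a : Q.Attack, V ≤ σ {S | Q.Intercepts α S a}) :
    V ≤ Q.patrolGuarantee α σ := by
  refine le_iInf₂ fun ν hν => ?_
  rw [payoff, Measure.prod_apply_symm (measurableSet_intercepts hα)]
  calc V = ∫⁻ _, V ∂ν := by simp
    _ ≤ _ := lintegral_mono h

theorem attackGuarantee_le [Finite A] {α : ℝ} (hα : 0 < α) {ν : Measure Q.Attack}
    [IsProbabilityMeasure ν] {V : ℝ≥0∞} (h : ∀ S : Q.Patrol, ν {a | Q.Intercepts α S a} ≤ V) :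
    Q.attackGuarantee α ν ≤ V := by
  refine iSup₂_le fun σ hσ => ?_
  rw [payoff, Measure.prod_apply (measurableSet_intercepts hα)]
  calc _ ≤ ∫⁻ _, V ∂σ := lintegral_mono h
    _ = V := by simp

theorem lowerValue_le_upperValue [Finite A] (α : ℝ) : Q.lowerValue α ≤ Q.upperValue α :=
  iSup₂_le fun σ hσ => le_iInf₂ fun ν hν =>
    (iInf₂_le (f := fun ν (_ : IsProbabilityMeasure ν) => Q.payoff α σ ν) ν hν).trans
      (le_iSup₂ (f := fun σ (_ : IsProbabilityMeasure σ) => Q.payoff α σ ν) σ hσ)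

theorem patrolGuarantee_le_lowerValue [Finite A] (α : ℝ) (σ : Measure Q.Patrol)
    [IsProbabilityMeasure σ] : Q.patrolGuarantee α σ ≤ Q.lowerValue α :=
  le_iSup₂ (f := fun σ (_ : IsProbabilityMeasure σ) => Q.patrolGuarantee α σ) σ inferInstance

theorem upperValue_le_attackGuarantee [Finite A] (α : ℝ) (ν : Measure Q.Attack)
    [IsProbabilityMeasure ν] : Q.upperValue α ≤ Q.attackGuarantee α ν :=
  iInf₂_le (f := fun ν (_ : IsProbabilityMeasure ν) => Q.attackGuarantee α ν) ν inferInstance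

theorem finite_leafSet [Finite N] : Q.leafSet.Finite := (Set.toFinite _).image _

/-- The points near the leaf nodes have total length at most `l * α / 2`. -/
theorem lengthMeasure_nearSet_leafSet_le [Finite N] [Fintype A] {α : ℝ}
    (hg : ENNReal.ofReal α ≤ Q.genGirth) :
    Q.lengthMeasure (Q.nearSet α Q.leafSet) ≤ ENNReal.ofReal (Q.leafSet.ncard * α / 2) := by
  have hfin := finite_leafSet (Q := Q)
  have h1 : Q.nearSet α Q.leafSet = ⋃ y ∈ hfin.toFinset, Metric.closedBall y (α / 2) := by
    ext x
    simp [nearSet]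
  have h2 : ∀ y ∈ hfin.toFinset,
      Q.lengthMeasure (Metric.closedBall y (α / 2)) ≤ ENNReal.ofReal (α / 2) := by
    intro y hy
    obtain ⟨x, hx, rfl⟩ := hfin.mem_toFinset.1 hy
    obtain ⟨d, rfl⟩ := Q.exists_dart x
    have h3 := le_two_mul_len_of_le_genGirth hg (isLeafArc_of_dsrc (Q := Q) hx)
    exact IsLeaf.lengthMeasure_closedBall_le hx (by linarith)
  rw [h1]
  calc _ ≤ ∑ y ∈ hfin.toFinset, Q.lengthMeasure (Metric.closedBall y (α / 2)) :=
        measure_biUnion_finset_le _ _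
    _ ≤ ∑ y ∈ hfin.toFinset, ENNReal.ofReal (α / 2) := Finset.sum_le_sum h2
    _ = _ := by
        rw [Finset.sum_const, ← Set.ncard_eq_toFinset_card _ hfin, nsmul_eq_mul, mul_div_assoc,
          ENNReal.ofReal_mul (Nat.cast_nonneg _), ENNReal.ofReal_natCast]

/-- With `λ(W) ≤ l * α / 2`, the denominator is at least `μ - l * α / 2 + l * α`. -/
theorem le_attackDenom [Finite N] [Fintype A] {α : ℝ} (hα : 0 < α)
    (hg : ENNReal.ofReal α ≤ Q.genGirth) :
    ENNReal.ofReal (Q.totalLength + Q.leafSet.ncard * α / 2) ≤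
      Q.lengthMeasure (Q.nearSet α Q.leafSet)ᶜ + Q.leafSet.ncard * ENNReal.ofReal α := by
  have h1 := lengthMeasure_nearSet_leafSet_le hg
  have h2 : Q.lengthMeasure univ ≤
      Q.lengthMeasure (Q.nearSet α Q.leafSet) + Q.lengthMeasure (Q.nearSet α Q.leafSet)ᶜ := by
    rw [← union_compl_self (Q.nearSet α Q.leafSet)]
    exact measure_union_le _ _
  have hc : (0 : ℝ) ≤ Q.leafSet.ncard * α / 2 := by positivity
  rw [ENNReal.ofReal_add Q.totalLength_pos.le hc, ← lengthMeasure_eq_ofReal,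
    ← ENNReal.ofReal_natCast, ← ENNReal.ofReal_mul (Nat.cast_nonneg _)]
  calc _ ≤ (ENNReal.ofReal (Q.leafSet.ncard * α / 2) + Q.lengthMeasure (Q.nearSet α Q.leafSet)ᶜ) +
        ENNReal.ofReal (Q.leafSet.ncard * α / 2) := by
        gcongr
        exact h2.trans (by gcongr)
    _ = Q.lengthMeasure (Q.nearSet α Q.leafSet)ᶜ + (ENNReal.ofReal (Q.leafSet.ncard * α / 2) +
        ENNReal.ofReal (Q.leafSet.ncard * α / 2)) := by ring
    _ = _ := by rw [← ENNReal.ofReal_add hc hc, add_halves]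

theorem attackGuarantee_leafSet_le [Finite N] [Fintype A] {α : ℝ} (hα : 0 < α)
    (hg : ENNReal.ofReal α ≤ Q.genGirth) :
    IsProbabilityMeasure (Q.independentAttack α Q.leafSet) ∧
      Q.attackGuarantee α (Q.independentAttack α Q.leafSet) ≤
        ENNReal.ofReal (α / (Q.totalLength + Q.leafSet.ncard * α / 2)) := by
  have hI := isIndependent_leafSet hg
  have hD := le_attackDenom hα hg
  have hpos : 0 < Q.totalLength + Q.leafSet.ncard * α / 2 := by
    have := Q.totalLength_pos
    positivity
  obtain ⟨I, hI'⟩ := (finite_leafSet (Q := Q)).exists_finset_coe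
  rw [← hI'] at hI hD hpos ⊢
  have hp := isProbabilityMeasure_independentAttack hα I
  refine ⟨hp, attackGuarantee_le hα fun S =>
    (independentAttack_intercepts_le hα I hI S).trans ?_⟩
  rw [ENNReal.ofReal_div_of_pos hpos]
  refine ENNReal.div_le_div_left ?_ _
  rwa [Set.ncard_coe_finset] at hD ⊢

theorem DoubleTour.le_patrolGuarantee [Fintype N] [Fintype A] (T : Q.DoubleTour) {α : ℝ}
    (hα : 0 < α) (hg : ENNReal.ofReal α ≤ Q.genGirth) :
    ENNReal.ofReal (α / (Q.totalLength + Q.leafSet.ncard * α / 2)) ≤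
      Q.patrolGuarantee α (T.paused α hα).randomizedExtension := by
  refine Network.le_patrolGuarantee hα fun a => ?_
  obtain ⟨x, τ⟩ := a
  obtain ⟨t₁, t₂, h₁₂, h₂₁, h₁, h₂⟩ := T.exists_visits hα hg x
  have h := (T.paused α hα).le_randomizedExtension_intercepts hα h₁₂ h₂₁ h₁ h₂ τ
  rw [T.paused_L hα] at h
  have heq : α / (Q.totalLength + Q.leafSet.ncard * α / 2) =
      2 * α / (2 * Q.totalLength + Q.leafSet.ncard * α) := by
    rw [← mul_div_mul_left α _ two_ne_zero]
    congr 1; ring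
  rwa [heq]

end Network

theorem mainTheorem2 {N : Type*} {A : Type*} [Fintype N] [Fintype A] (Q : Network N A)
    (α : ℝ) (hα : 0 < α) (hg : ENNReal.ofReal α ≤ Q.genGirth) :
    Q.IsValue α (α / (Q.totalLength + Q.leafSet.ncard * α / 2)) ∧
    Nonempty Q.DoubleTour ∧
    (∀ S₂ : Q.DoubleTour, Q.IsOptimalPatrol α (S₂.paused α hα).randomizedExtension) ∧
    Q.IsIndependent α Q.leafSet ∧
    Q.IsOptimalAttack α (Q.independentAttack α Q.leafSet) := by
  obtain ⟨hp, hle⟩ := Network.attackGuarantee_leafSet_le hα hg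
  have hup := Q.upperValue_le_attackGuarantee α (Q.independentAttack α Q.leafSet)
  have hlow := fun T : Q.DoubleTour =>
    Q.patrolGuarantee_le_lowerValue α (T.paused α hα).randomizedExtension
  have hge := fun T : Q.DoubleTour => T.le_patrolGuarantee hα hg
  have hlu := Q.lowerValue_le_upperValue α
  obtain ⟨T⟩ := Q.nonempty_doubleTour
  -- The Patroller's guarantee, the two values and the Attacker's guarantee form an increasing chain
  -- that starts at or above `V` and ends at or below it.
  have hl : Q.lowerValue α = ENNReal.ofReal (α / (Q.totalLength + Q.leafSet.ncard * α / 2)) :=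
    le_antisymm (hlu.trans (hup.trans hle)) ((hge T).trans (hlow T))
  have hu : Q.upperValue α = ENNReal.ofReal (α / (Q.totalLength + Q.leafSet.ncard * α / 2)) :=
    le_antisymm (hup.trans hle) (hl ▸ hlu)
  exact ⟨⟨hl, hu⟩, ⟨T⟩, fun T => ⟨inferInstance, le_antisymm (hlow T) (hl ▸ hge T)⟩,
    Network.isIndependent_leafSet hg, hp, le_antisymm (hu ▸ hle) hup⟩
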